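/- **Setting.** Consider a finite stochastic game: finite state space $S$, finite player set $I$, finite action sets $A^i$, $A=\prod_i A^i$, stage rewards $r^i_s:A\to\mathbb R$, transition probabilities $P_s:A\to\Delta(S)$ (with $P_{st}(a)$ the probability of moving from $s$ to $t$), and a discount factor $\delta\in(0,1)$. Assume that it is of identical interest: $r^i_s=r_s$ for all players $i$. Player $i$'s payoff from an initial state is the expectation of $(1-\delta)\sum_{k\ge0}\delta^k r^i_{s_k}(a_k)$. A stationary Nash equilibrium is a profile $x=(x^i_s)$ with $x^i_s\in\Delta(A^i)$ such that, from every initial state, no player can increase their payoff by deviating to any (history-dependent, randomized) behavioral strategy; its payoff vector over $I\times S$ is called a stationary equilibrium payoff. For $v\in\mathbb R^S$ let $f^i_{s,v}(a)=(1-\delta)r^i_s(a)+\delta\sum_{t\in S}P_{st}(a)v_t$, extended multilinearly to mixed action profiles, and let $\mathrm{br}^i_{s,v}(x_s^{-i})=\operatorname{argmax}_{b\in A^i}f^i_{s,v}(b,x_s^{-i})$. Pure actions are identified with vertices of $\Delta(A^i)$. Let $(\alpha_n)_{n\ge0}$ and $\sigma_n=\sum_{k=0}^n\alpha_k$ satisfy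 $$\text{(H1)}\qquad \sum_k\frac{\alpha_k}{\sigma_k}=\infty,\qquad 0<\alpha_n\le1,\qquad \alpha_{n+1}\le\alpha_n .$$ In both procedures below $x_0$ is an arbitrary stationary profile, $u_0^i\in\mathbb R^S$ is arbitrary but the same for all players, and for all $n\ge0$, $i\in I$, $s\in S$, $$u^i_{n+1,s}-u^i_{n,s}=\frac{\alpha_n}{\sigma_n}\bigl(f^i_{s,u^i_n}(x_{n,s})-u^i_{n,s}\bigr).$$ * **(SFP)** For every $n\ge0$, $s\in S$, $i\in I$ an action $a^i_{n,s}\in\mathrm{br}^i_{s,u^i_n}(x^{-i}_{n,s})$ is chosen, and $x^i_{n+1,s}-x^i_{n,s}=\frac1{n+1}\bigl(a^i_{n,s}-x^i_{n,s}\bigr)$. * **(AFP)** (also called SAFP) The game is played: at stage $n$ in state $s_n$ each player $i$ plays $a^i_n\in\mathrm{br}^i_{s_n,u^i_n}(x^{-i}_{n,s_n})$, and given $(s_0,a_0,\dots,s_n,a_n)$ the next state $s_{n+1}$ has distribution $P_{s_n}(a_n)$. For all $s$ and $i$, $x^i_{n+1,s}-x^i_{n,s}=\frac{1_{s_n=s}}{s^\sharp_n}\bigl(a^i_n-x^i_{n,s}\bigr)$,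 where $s^\sharp_n=\#\{k: 0\le k\le n,\ s_k=s\}$ (the right-hand side is $0$ if $s_n\neq s$). The rule for selecting among several best responses is arbitrary. The game is *ergodic* if there is a finite $T$ such that for all $s,s'\in S$, whatever actions are taken (possibly depending on the stage and on the states met), the system started in $s$ is in $s'$ after $T$ steps with positive probability. **Theorem (Convergence of FP rules in identical interest stochastic games).** Under (H1), in an identical interest discounted stochastic game: 1. for every realization of SFP, $x_n$ converges to the set of stationary Nash equilibria (i.e. its distance to this nonempty set tends to $0$), and $u_n$ converges to a stationary equilibrium payoff $\Phi$, where moreover $x_n$ converges to the set of stationary Nash equilibria with payoff $\Phi$; 2. if in addition the game is ergodic, the same conclusions hold almost surely for AFP. In particular both procedures converge almost surely in ergodic games, and SFP converges without ergodicity. -/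

import Mathlib

open Filter Topology MeasureTheory

/-- A finite stochastic game with state space `S`, player set `ι` and action sets `A i`:
`r i s a` is the stage reward of player `i` in state `s` under the action profile `a`, and
`P s a` is the distribution of the next state.  (Finiteness of `S`, `ι`, `A i` is imposed by
instances wherever it is used.) -/
structure StochGame (ι S : Type*) (A : ι → Type*) [Fintype S] where
  r : ι → S → (∀ i, A i) → ℝ
  P : S → (∀ i, A i) → stdSimplex ℝ S

/-- A behavioral strategy of player `i`: a mixed action for every finite history (the list, in
chronological order, of the past pairs of state and action profile) and every current state. -/
abbrev BehavioralStrategy {ι : Type*} (S : Type*) (A : ι → Type*) (i : ι) [Fintype (A i)] :=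
  List (S × (∀ j, A j)) → S → stdSimplex ℝ (A i)

/-- Stationary strategy profiles: one mixed action per player and per state. -/
abbrev StationaryProfile {ι : Type*} (S : Type*) (A : ι → Type*) [∀ i, Fintype (A i)] :=
  ∀ i, S → stdSimplex ℝ (A i)

/-- A stationary strategy seen as a behavioral one that ignores the history. -/
def StationaryProfile.toBehavioral {ι S : Type*} {A : ι → Type*} [∀ i, Fintype (A i)]
    (x : StationaryProfile S A) (i : ι) : BehavioralStrategy S A i :=
  fun _ s => x i s

namespace StochGame

variable {ι S : Type*} {A : ι → Type*} [Fintype ι] [DecidableEq ι] [Fintype S] [DecidableEq S]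
  [∀ i, Fintype (A i)] [∀ i, DecidableEq (A i)]

/-- All players have the same stage reward function. -/
def IdenticalInterest (G : StochGame ι S A) : Prop :=
  ∃ r : S → (∀ i, A i) → ℝ, ∀ i s a, G.r i s a = r s a

/-- The probability to be in state `t` after `n` steps when starting from `s`, if at stage `k` the
action profile `c k m` is taken whenever the current state is `m`. -/
def stepProb (G : StochGame ι S A) (c : ℕ → S → (∀ i, A i)) : ℕ → S → S → ℝ
  | 0, s, t => if s = t then 1 else 0
  | n + 1, s, t => ∑ m, stepProb G c n s m * (G.P m (c n m) : S → ℝ) t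

/-- Ergodicity: for some finite time `T`, every state is reached from every state after `T` steps
with positive probability, whatever actions are taken (actions may depend on the stage and on the
current state; letting them depend on the whole past, or be randomized, gives the same notion). -/
def Ergodic (G : StochGame ι S A) : Prop :=
  ∃ T : ℕ, ∀ (c : ℕ → S → (∀ i, A i)) (s t : S), 0 < G.stepProb c T s t

/-- The expected stage reward of player `i`, `k` stages from now, when the past history is `h`, the
current state is `s`, the players draw their actions independently according to the behavioral
strategies `σ`, and the states follow the transition law of the game. -/
def expReward (G : StochGame ι S A) (σ : ∀ j, BehavioralStrategy S A j) (i : ι) :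
    ℕ → List (S × (∀ j, A j)) → S → ℝ
  | 0, h, s => ∑ a : (∀ j, A j), (∏ j, (σ j h s : A j → ℝ) (a j)) * G.r i s a
  | k + 1, h, s => ∑ a : (∀ j, A j), (∏ j, (σ j h s : A j → ℝ) (a j)) *
      ∑ t, (G.P s a : S → ℝ) t * expReward G σ i k (h ++ [(s, a)]) t

/-- Expected normalized `δ`-discounted payoff of player `i` when the play starts in state `s`. -/
noncomputable def payoff (G : StochGame ι S A) (δ : ℝ) (σ : ∀ j, BehavioralStrategy S A j)
    (i : ι) (s : S) : ℝ :=
  (1 - δ) * ∑' k : ℕ, δ ^ k * G.expReward σ i k [] s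

/-- Nash equilibrium of the discounted game: from no initial state does a player have a profitable
deviation among all behavioral strategies. -/
def IsNash (G : StochGame ι S A) (δ : ℝ) (σ : ∀ j, BehavioralStrategy S A j) : Prop :=
  ∀ (i : ι) (τ : BehavioralStrategy S A i) (s : S),
    G.payoff δ (Function.update σ i τ) i s ≤ G.payoff δ σ i s

/-- The set of stationary Nash equilibria. -/
def stationaryNash (G : StochGame ι S A) (δ : ℝ) : Set (StationaryProfile S A) :=
  {x | G.IsNash δ x.toBehavioral}

/-- The set of stationary Nash equilibria whose payoff vector (over players and initial states)
is `Φ`. -/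
def stationaryNashWithPayoff (G : StochGame ι S A) (δ : ℝ) (Φ : ι → S → ℝ) :
    Set (StationaryProfile S A) :=
  {x | x ∈ G.stationaryNash δ ∧ ∀ i s, G.payoff δ x.toBehavioral i s = Φ i s}

/-- Payoff of player `i` in the auxiliary game at state `s` with continuation payoffs `v`, extended
multilinearly to mixed action profiles:
`f^i_{s,v}(y) = (1 - δ) r^i_s(y) + δ ∑_t P_{s t}(y) v_t`. -/
def aux (G : StochGame ι S A) (δ : ℝ) (i : ι) (s : S) (v : S → ℝ)
    (y : ∀ j, A j → ℝ) : ℝ :=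
  ∑ a : (∀ j, A j), (∏ j, y j (a j)) *
    ((1 - δ) * G.r i s a + δ * ∑ t, (G.P s a : S → ℝ) t * v t)

/-- The mixed action profile that `x` prescribes in state `s`. -/
def atState (x : StationaryProfile S A) (s : S) : ∀ j, A j → ℝ :=
  fun j => (x j s : A j → ℝ)

/-- The pure best responses of player `i` to `x^{-i}_s` in the auxiliary game at `s`. -/
def bestResponse (G : StochGame ι S A) (δ : ℝ) (i : ι) (s : S) (v : S → ℝ)
    (x : StationaryProfile S A) : Set (A i) :=
  {b | ∀ b' : A i,
    G.aux δ i s v (Function.update (atState x s) i (Pi.single b' 1)) ≤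
      G.aux δ i s v (Function.update (atState x s) i (Pi.single b 1))}

/-- `σ_n = α_0 + ... + α_n`. -/
def stepSum (α : ℕ → ℝ) (n : ℕ) : ℝ := ∑ k ∈ Finset.range (n + 1), α k

/-- The assumption (H1) on the step sizes. -/
structure StepSizes (α : ℕ → ℝ) : Prop where
  diverge : Tendsto (fun n => ∑ k ∈ Finset.range n, α k / stepSum α k) atTop atTop
  pos : ∀ n, 0 < α n
  le_one : ∀ n, α n ≤ 1
  antitone : Antitone α

/-- Update of the continuation estimates, for all players and all states at every stage, from a
starting value that is the same for all players. -/
def PayoffUpdate (G : StochGame ι S A) (δ : ℝ) (α : ℕ → ℝ)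
    (x : ℕ → StationaryProfile S A) (u : ℕ → ι → S → ℝ) : Prop :=
  (∀ i j, u 0 i = u 0 j) ∧
  ∀ n i s, u (n + 1) i s - u n i s =
    α n / stepSum α n * (G.aux δ i s (u n i) (atState (x n) s) - u n i s)

/-- Synchronous fictitious play: at every stage `n`, `a n s i` is the action that player `i`
provides for state `s`.  Starting values are arbitrary. -/
structure IsSFP (G : StochGame ι S A) (δ : ℝ) (α : ℕ → ℝ) (a : ℕ → S → (∀ i, A i))
    (x : ℕ → StationaryProfile S A) (u : ℕ → ι → S → ℝ) : Prop where
  payoff_update : G.PayoffUpdate δ α x u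
  action_update : ∀ n i s, (x (n + 1) i s : A i → ℝ) - (x n i s : A i → ℝ) =
    (1 / ((n : ℝ) + 1)) • (Pi.single (a n s i) 1 - (x n i s : A i → ℝ))
  best_response : ∀ n i s, a n s i ∈ G.bestResponse δ i s (u n i) (x n)

/-- The number of visits of `t` between the stages `0` and `n` (both included). -/
def visits (s : ℕ → S) (t : S) (n : ℕ) : ℕ :=
  ((Finset.range (n + 1)).filter (fun k => s k = t)).card

/-- Asynchronous fictitious play along one realized play `s 0, a 0, s 1, a 1, ...`.  Starting
values are arbitrary. -/
structure IsAFP (G : StochGame ι S A) (δ : ℝ) (α : ℕ → ℝ) (s : ℕ → S) (a : ℕ → (∀ i, A i))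
    (x : ℕ → StationaryProfile S A) (u : ℕ → ι → S → ℝ) : Prop where
  payoff_update : G.PayoffUpdate δ α x u
  action_update : ∀ n i t, (x (n + 1) i t : A i → ℝ) - (x n i t : A i → ℝ) =
    ((if s n = t then 1 else 0) / (visits s t n : ℝ)) •
      (Pi.single (a n i) 1 - (x n i t : A i → ℝ))
  best_response : ∀ n i, a n i ∈ G.bestResponse δ i (s n) (u n i) (x n)

/-- The random sequence `s 0, a 0, s 1, a 1, ...` is a play of the stochastic game: given the
history of states and actions up to stage `n`, the next state has the distribution
`P_{s_n}(a_n)`.  Nothing is imposed on how actions are selected, so that all behavioral strategies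
are covered. -/
structure IsPlay (G : StochGame ι S A) {Ω : Type*} [MeasurableSpace Ω] (μ : Measure Ω)
    (s : ℕ → Ω → S) (a : ℕ → Ω → (∀ i, A i)) : Prop where
  measurable_state : ∀ n t, MeasurableSet {ω | s n ω = t}
  measurable_action : ∀ n b, MeasurableSet {ω | a n ω = b}
  transition : ∀ (n : ℕ) (p : ℕ → S) (q : ℕ → (∀ i, A i)) (t : S),
    μ ({ω | ∀ k ≤ n, s k ω = p k ∧ a k ω = q k} ∩ {ω | s (n + 1) ω = t}) =
      μ {ω | ∀ k ≤ n, s k ω = p k ∧ a k ω = q k} *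
        ENNReal.ofReal ((G.P (p n) (q n) : S → ℝ) t)

/-- The distance of `x n` to the set `E` tends to `0` (in particular `E` is not empty). -/
def ConvergesToSet {X : Type*} [PseudoMetricSpace X] (x : ℕ → X) (E : Set X) : Prop :=
  ∀ ε > 0, ∃ N, ∀ n ≥ N, ∃ y ∈ E, dist (x n) y < ε

/-- The empirical actions `x n` converge to the set of stationary Nash equilibria, and the
continuation estimates `u n` converge to a stationary equilibrium payoff `Φ`, which is the payoff of
the equilibria that `x n` approaches. -/
def ConvergesToEquilibria (G : StochGame ι S A) (δ : ℝ)
    (x : ℕ → StationaryProfile S A) (u : ℕ → ι → S → ℝ) : Prop :=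
  ConvergesToSet x (G.stationaryNash δ) ∧
  ∃ Φ : ι → S → ℝ, Tendsto u atTop (𝓝 Φ) ∧ (G.stationaryNashWithPayoff δ Φ).Nonempty ∧
    ConvergesToSet x (G.stationaryNashWithPayoff δ Φ)

end StochGame

/-!
Since the interest is common and the initial estimates agree, all players hold the same continuation
estimates `u n`, and in each state the auxiliary game with continuation payoffs `u n` is a common
interest game, whose payoff is the multilinear extension `mixedExt` of a function of pure profiles.
Both procedures are instances of `StochGame.IsWeightedFP`: the estimates move with step
`γ n = α n / σ n`, the profile in state `s` moves towards best responses with a weight `w n s`, which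
is `1 / (n + 1)` in the synchronous case and `1, 1/2, 1/3, ...` at the successive visits of `s` in the
asynchronous one. What matters is that `γ n ≤ 1`, `∑ γ n = ∞`, `∑ w n s = ∞` and
`∑ (w n s) ^ 2 < ∞`.

Let the excess `D n s` be the auxiliary payoff of the current profile minus the estimate `u n s`. A
first order expansion of the multilinear payoff (`le_mixedExt_add_smul`) gives
`D (n+1) s ≥ (1 - γ n) D n s + δ γ n min D n + w n s * (total gain of the best responses) - C (w n s)^2`
(`le_excess_succ`). The gains are nonnegative, so the negative part of `D` contracts at rate
`(1 - δ) γ n` up to summable errors, and is summable against `γ` (`exists_lower_bound`). Hence the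
bounded estimates increase up to summable errors: they converge, and `∑ γ n |D n s| < ∞`
(`summable_excess`). Now `D` itself increases up to summable errors, so it converges, necessarily to
`0`, and the gains are summable against `w` (`tendsto_excess`). The increments of a gain are `O(w n s)`
up to summable terms, so its square decreases up to summable errors, and the gain tends to `0`
(`tendsto_zero_of_slow_variation`, `tendsto_gain`). Every limit point of the profiles is therefore an
equilibrium, with payoff `Φ = lim u n`, of the auxiliary games with continuation payoffs `Φ`. By the
one-shot deviation principle (`mem_stationaryNashWithPayoff`) it is a Nash equilibrium of the
stochastic game with payoff `Φ`, and compactness concludes.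

In the asynchronous procedure the divergence of `∑ w n s` says that every state is visited infinitely
often. Ergodicity yields a uniform positive lower bound for the conditional probability to meet a
state `T` stages later (`mul_real_le_of_determined`), so avoiding a state forever has probability `0`
(`ae_frequently_visited`).
-/

/-! ### Multilinear extensions -/

section MultilinearExtension

variable {ι : Type*} {A : ι → Type*} [Fintype ι] [DecidableEq ι] [∀ i, Fintype (A i)]

/-- The multilinear extension to mixed profiles of a function `c` of pure action profiles. -/
def mixedExt (c : (∀ j, A j) → ℝ) : MultilinearMap ℝ (fun j => A j → ℝ) ℝ :=
  ∑ a : (∀ j, A j), c a •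
    (MultilinearMap.mkPiAlgebra ℝ ι ℝ).compLinearMap (fun j => LinearMap.proj (a j))

theorem mixedExt_apply (c : (∀ j, A j) → ℝ) (y : ∀ j, A j → ℝ) :
    mixedExt c y = ∑ a : (∀ j, A j), (∏ j, y j (a j)) * c a := by
  simp [mixedExt, mul_comm]

theorem abs_mixedExt_le_card_mul {c : (∀ j, A j) → ℝ} {M : ℝ} (hc : ∀ a, |c a| ≤ M)
    {y : ∀ j, A j → ℝ} (hy : ∀ j b, |y j b| ≤ 1) :
    |mixedExt c y| ≤ Fintype.card (∀ j, A j) * M := by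
  rw [mixedExt_apply]
  refine (Finset.abs_sum_le_sum_abs _ _).trans ?_
  have : ∀ a ∈ (Finset.univ : Finset (∀ j, A j)), |(∏ j, y j (a j)) * c a| ≤ M := by
    intro a _
    rw [abs_mul, Finset.abs_prod]
    have h1 : ∏ j, |y j (a j)| ≤ 1 := Finset.prod_le_one (fun _ _ => abs_nonneg _) fun j _ => hy j _
    have h2 := abs_nonneg (c a)
    nlinarith [hc a]
  refine (Finset.sum_le_card_nsmul _ _ _ this).trans ?_
  simp

theorem sum_prod_eq_one {y : ∀ j, A j → ℝ} (hy : ∀ j, y j ∈ stdSimplex ℝ (A j)) :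
    ∑ a : (∀ j, A j), ∏ j, y j (a j) = 1 := by
  have := Finset.prod_univ_sum (fun j => (Finset.univ : Finset (A j))) y
  rw [Fintype.piFinset_univ] at this
  rw [← this]
  exact Finset.prod_eq_one fun j _ => (hy j).2

theorem mixedExt_mono {c c' : (∀ j, A j) → ℝ} (h : ∀ a, c a ≤ c' a) {y : ∀ j, A j → ℝ}
    (hy : ∀ j, y j ∈ stdSimplex ℝ (A j)) : mixedExt c y ≤ mixedExt c' y := by
  rw [mixedExt_apply, mixedExt_apply]
  exact Finset.sum_le_sum fun a _ =>
    mul_le_mul_of_nonneg_left (h a) (Finset.prod_nonneg fun j _ => (hy j).1 _)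

theorem mixedExt_const (M : ℝ) {y : ∀ j, A j → ℝ} (hy : ∀ j, y j ∈ stdSimplex ℝ (A j)) :
    mixedExt (fun _ => M) y = M := by
  rw [mixedExt_apply, ← Finset.sum_mul, sum_prod_eq_one hy, one_mul]

theorem mixedExt_sub (c c' : (∀ j, A j) → ℝ) (y : ∀ j, A j → ℝ) :
    mixedExt c y - mixedExt c' y = mixedExt (fun a => c a - c' a) y := by
  simp only [mixedExt_apply, mul_sub, Finset.sum_sub_distrib]

theorem mixedExt_add_const (c : (∀ j, A j) → ℝ) (d : ℝ) {y : ∀ j, A j → ℝ}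
    (hy : ∀ j, y j ∈ stdSimplex ℝ (A j)) :
    mixedExt (fun a => c a + d) y = mixedExt c y + d := by
  have h := mixedExt_sub (fun a => c a + d) c y
  simp only [add_sub_cancel_left] at h
  rw [mixedExt_const d hy] at h
  linarith

theorem abs_mixedExt_le {c : (∀ j, A j) → ℝ} {M : ℝ} (hc : ∀ a, |c a| ≤ M)
    {y : ∀ j, A j → ℝ} (hy : ∀ j, y j ∈ stdSimplex ℝ (A j)) : |mixedExt c y| ≤ M := by
  rw [abs_le]
  constructor
  · have := mixedExt_mono (fun a => neg_le_of_abs_le (hc a)) hy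
    rwa [mixedExt_const _ hy] at this
  · have := mixedExt_mono (fun a => le_of_abs_le (hc a)) hy
    rwa [mixedExt_const _ hy] at this

/-- Expansion in powers of the step size `w`. The set `T` collects the players whose mixed action is
replaced by their direction of movement. -/
theorem mixedExt_add_smul (c : (∀ j, A j) → ℝ) (y d : ∀ j, A j → ℝ) (w : ℝ) :
    mixedExt c (y + w • d) =
      ∑ T : Finset ι, w ^ T.card * mixedExt c (T.piecewise d y) := by
  rw [add_comm, MultilinearMap.map_add_univ]
  refine Finset.sum_congr rfl fun T _ => ?_
  have : T.piecewise (w • d) y = T.piecewise (fun j => (fun _ : ι => w) j • T.piecewise d y j)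
      (T.piecewise d y) := by
    ext j : 1
    by_cases hj : j ∈ T <;> simp [hj]
  rw [this, MultilinearMap.map_piecewise_smul]
  simp

theorem abs_mixedExt_piecewise_le {c : (∀ j, A j) → ℝ} {M : ℝ} (hc : ∀ a, |c a| ≤ M)
    {y d : ∀ j, A j → ℝ} (hy : ∀ j b, |y j b| ≤ 1) (hd : ∀ j b, |d j b| ≤ 1) (T : Finset ι) :
    |mixedExt c (T.piecewise d y)| ≤ Fintype.card (∀ j, A j) * M := by
  refine abs_mixedExt_le_card_mul hc fun j b => ?_
  by_cases hj : j ∈ T <;> simp [hj, hy, hd]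

/-- Lipschitz bound for a step of size `w`. -/
theorem abs_mixedExt_add_smul_sub_le {c : (∀ j, A j) → ℝ} {M : ℝ} (hc : ∀ a, |c a| ≤ M)
    {y d : ∀ j, A j → ℝ} (hy : ∀ j b, |y j b| ≤ 1) (hd : ∀ j b, |d j b| ≤ 1)
    {w : ℝ} (hw0 : 0 ≤ w) (hw1 : w ≤ 1) :
    |mixedExt c (y + w • d) - mixedExt c y| ≤
      Fintype.card (Finset ι) * (Fintype.card (∀ j, A j) * M) * w := by
  have h0 : mixedExt c y = ∑ T : Finset ι, if T = ∅ then mixedExt c y else 0 := by simp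
  rw [mixedExt_add_smul]
  conv_lhs => rw [h0, ← Finset.sum_sub_distrib]
  refine (Finset.abs_sum_le_sum_abs _ _).trans ?_
  have : ∀ T ∈ (Finset.univ : Finset (Finset ι)),
      |w ^ T.card * mixedExt c (T.piecewise d y) - (if T = ∅ then mixedExt c y else 0)| ≤
        Fintype.card (∀ j, A j) * M * w := by
    intro T _
    have hB := abs_mixedExt_piecewise_le hc hy hd T
    have hB0 := (abs_nonneg _).trans hB
    by_cases hT : T = ∅
    · subst hT
      simpa using mul_nonneg hB0 hw0
    · have hcard : T.card ≠ 0 := by simpa using hT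
      rw [if_neg hT, sub_zero, abs_mul, abs_of_nonneg (pow_nonneg hw0 _), mul_comm]
      exact mul_le_mul hB (pow_le_of_le_one hw0 hw1 hcard) (pow_nonneg hw0 _) hB0
  refine (Finset.sum_le_card_nsmul _ _ _ this).trans ?_
  simp [mul_assoc]

/-- First order expansion along a simultaneous step of all players from `y` towards `a`: the first
order term is the sum over the players of what each gains by moving alone. -/
theorem le_mixedExt_add_smul {c : (∀ j, A j) → ℝ} {M : ℝ} (hc : ∀ a, |c a| ≤ M)
    {y a : ∀ j, A j → ℝ} (hy : ∀ j b, |y j b| ≤ 1) (hd : ∀ j b, |(a - y) j b| ≤ 1)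
    {w : ℝ} (hw0 : 0 ≤ w) (hw1 : w ≤ 1) :
    mixedExt c y + w * ∑ i, (mixedExt c (Function.update y i (a i)) - mixedExt c y)
      - Fintype.card (Finset ι) * (Fintype.card (∀ j, A j) * M) * w ^ 2 ≤
      mixedExt c (y + w • (a - y)) := by
  set B : ℝ := Fintype.card (∀ j, A j) * M
  have h0 : mixedExt c y = ∑ T : Finset ι, if T = ∅ then mixedExt c y else 0 := by simp
  have h1 : ∑ i, (mixedExt c (Function.update y i (a i)) - mixedExt c y) =
      ∑ T : Finset ι, if T.card = 1 then mixedExt c (T.piecewise (a - y) y) else 0 := by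
    rw [← Finset.sum_filter]
    have : (Finset.univ.filter fun T : Finset ι => T.card = 1) =
        Finset.univ.map ⟨fun i : ι => ({i} : Finset ι), Finset.singleton_injective⟩ := by
      ext T
      simp [Finset.card_eq_one, eq_comm]
    rw [this, Finset.sum_map]
    refine Finset.sum_congr rfl fun i _ => ?_
    simp only [Function.Embedding.coeFn_mk, Finset.piecewise_singleton, Pi.sub_apply]
    rw [MultilinearMap.map_update_sub, Function.update_eq_self]
  have h2 : (Fintype.card (Finset ι) : ℝ) * B * w ^ 2 = ∑ T : Finset ι, B * w ^ 2 := by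
    simp [mul_assoc]
  rw [h2, mixedExt_add_smul]
  nth_rw 1 [h0]
  rw [h1, Finset.mul_sum, ← Finset.sum_add_distrib, ← Finset.sum_sub_distrib]
  refine Finset.sum_le_sum fun T _ => ?_
  have hB := abs_mixedExt_piecewise_le hc hy hd T
  have hB0 := (abs_nonneg _).trans hB
  rcases Nat.lt_or_ge 1 T.card with hT | hT
  · have hne : T ≠ ∅ := by rintro rfl; simp at hT
    rw [if_neg hne, if_neg hT.ne']
    have hp : w ^ T.card ≤ w ^ 2 := pow_le_pow_of_le_one hw0 hw1 hT
    have hp0 : 0 ≤ w ^ T.card := pow_nonneg hw0 _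
    have := neg_le_of_abs_le hB
    nlinarith [mul_le_mul_of_nonneg_left this hp0, mul_le_mul_of_nonneg_left hp hB0]
  · have hn := mul_nonneg hB0 (sq_nonneg w)
    rcases Nat.le_one_iff_eq_zero_or_eq_one.1 hT with hT | hT
    · obtain rfl := Finset.card_eq_zero.1 hT
      rw [Finset.piecewise_empty, Finset.card_empty, if_pos rfl, if_neg zero_ne_one]
      linarith
    · have hne : T ≠ ∅ := by rintro rfl; simp at hT
      rw [if_neg hne, if_pos hT, hT]
      linarith

variable [∀ i, DecidableEq (A i)]

/-- Multilinearity in the mixed action of player `i`, as an average over pure actions. -/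
theorem mixedExt_update_eq_sum (c : (∀ j, A j) → ℝ) (y : ∀ j, A j → ℝ) (i : ι) (z : A i → ℝ) :
    mixedExt c (Function.update y i z) =
      ∑ b, z b * mixedExt c (Function.update y i (Pi.single b 1)) := by
  have hz : z = ∑ b, z b • (Pi.single b 1 : A i → ℝ) := by
    ext b'
    simp [Finset.sum_apply, Pi.single_apply]
  conv_lhs => rw [hz]
  rw [MultilinearMap.map_update_sum]
  exact Finset.sum_congr rfl fun b _ => by rw [MultilinearMap.map_update_smul, smul_eq_mul]

end MultilinearExtension

/-! ### Almost monotone real sequences -/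

section Sequences

theorem sum_le_tsum_range {e : ℕ → ℝ} (he : Summable e) (he0 : ∀ n, 0 ≤ e n) (n : ℕ) :
    ∑ k ∈ Finset.range n, e k ≤ ∑' k, e k :=
  he.sum_le_tsum _ fun k _ => he0 k

/-- A sequence that is bounded above and increases up to summable errors converges. -/
theorem exists_tendsto_of_almost_monotone {z e : ℕ → ℝ} {M : ℝ} (hM : ∀ n, z n ≤ M)
    (he : Summable e) (he0 : ∀ n, 0 ≤ e n) (h : ∀ n, z n - e n ≤ z (n + 1)) :
    ∃ l, Tendsto z atTop (𝓝 l) := by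
  have hmono : Monotone fun n => z n + ∑ k ∈ Finset.range n, e k :=
    monotone_nat_of_le_succ fun n => by
      have := h n
      rw [Finset.sum_range_succ]
      linarith
  have hbdd : BddAbove (Set.range fun n => z n + ∑ k ∈ Finset.range n, e k) := by
    refine ⟨M + ∑' k, e k, ?_⟩
    rintro _ ⟨n, rfl⟩
    exact add_le_add (hM n) (sum_le_tsum_range he he0 n)
  have h1 := tendsto_atTop_ciSup hmono hbdd
  have h2 := h1.sub he.hasSum.tendsto_sum_nat
  exact ⟨_, by simpa using h2⟩

/-- The gains of a sequence that is bounded above and loses only summable amounts are summable. -/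
theorem summable_of_almost_increments {z p e : ℕ → ℝ} {M : ℝ} (hM : ∀ n, z n ≤ M)
    (hp0 : ∀ n, 0 ≤ p n) (he : Summable e) (he0 : ∀ n, 0 ≤ e n)
    (h : ∀ n, z n + p n - e n ≤ z (n + 1)) : Summable p := by
  refine summable_of_sum_range_le (c := M - z 0 + ∑' k, e k) hp0 fun n => ?_
  have : ∑ k ∈ Finset.range n, p k ≤ z n - z 0 + ∑ k ∈ Finset.range n, e k := by
    induction n with
    | zero => simp
    | succ n ih =>
      rw [Finset.sum_range_succ, Finset.sum_range_succ]
      linarith [h n]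
  linarith [hM n, sum_le_tsum_range he he0 n]

/-- A convergent sequence which is summable against weights of infinite sum tends to zero. -/
theorem tendsto_zero_of_summable_mul {z w : ℕ → ℝ} {l : ℝ} (hz : Tendsto z atTop (𝓝 l))
    (hw0 : ∀ n, 0 ≤ w n) (hw : ¬ Summable w) (h : Summable fun n => w n * |z n|) :
    Tendsto z atTop (𝓝 0) := by
  suffices l = 0 by rwa [← this]
  by_contra hl
  refine hw ?_
  have h1 : ∀ᶠ n in atTop, |l| / 2 < |z n| :=
    hz.abs.eventually_const_lt (half_lt_self (abs_pos.2 hl))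
  have hl' := abs_pos.2 hl
  refine (h.mul_left (2 / |l|)).of_norm_bounded_eventually_nat ?_
  filter_upwards [h1] with n hn
  rw [Real.norm_of_nonneg (hw0 n)]
  have : 1 ≤ 2 / |l| * |z n| := by
    rw [div_mul_eq_mul_div, le_div_iff₀ hl']
    linarith
  nlinarith [hw0 n]

/-- If `g` is summable against square summable weights `w` of infinite sum, and the increments of
`g` are at most of the order of `w` up to summable terms, then `g` tends to zero: indeed `g ^ 2`
decreases up to summable errors. -/
theorem tendsto_zero_of_slow_variation {g w e : ℕ → ℝ} {M C : ℝ} (hg0 : ∀ n, 0 ≤ g n)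
    (hgM : ∀ n, g n ≤ M) (hC : 0 ≤ C) (hw0 : ∀ n, 0 ≤ w n) (hw : ¬ Summable w)
    (hw2 : Summable fun n => w n ^ 2) (he0 : ∀ n, 0 ≤ e n) (he : Summable e)
    (h : Summable fun n => w n * g n) (hstep : ∀ n, g (n + 1) ≤ g n + (C * w n + e n)) :
    Tendsto g atTop (𝓝 0) := by
  have hM0 : 0 ≤ M := (hg0 0).trans (hgM 0)
  have he1 : ∀ n, e n ≤ ∑' k, e k := fun n => he.le_tsum n fun k _ => he0 k
  set E := ∑' k, e k
  have hE0 : 0 ≤ E := (he0 0).trans (he1 0)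
  have herr : Summable fun n =>
      2 * C * (w n * g n) + 2 * M * e n + (2 * C ^ 2 * w n ^ 2 + 2 * E * e n) :=
    ((h.mul_left _).add (he.mul_left _)).add ((hw2.mul_left _).add (he.mul_left _))
  obtain ⟨l, hl⟩ := exists_tendsto_of_almost_monotone (z := fun n => -(g n ^ 2)) (M := 0)
    (fun n => by nlinarith [hg0 n]) herr
    (fun n => by
      have := hg0 n; have := hw0 n; have := he0 n
      positivity)
    (fun n => by
      have h1 := pow_le_pow_left₀ (hg0 (n + 1)) (hstep n) 2
      have h2 := mul_le_mul_of_nonneg_right (hgM n) (he0 n)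
      have h3 := mul_le_mul_of_nonneg_right (he1 n) (he0 n)
      nlinarith [sq_nonneg (C * w n - e n)])
  have h0 := tendsto_zero_of_summable_mul hl hw0 hw (by
    refine (h.mul_left M).of_nonneg_of_le (fun n => mul_nonneg (hw0 n) (abs_nonneg _)) fun n => ?_
    rw [abs_neg, abs_of_nonneg (sq_nonneg _)]
    nlinarith [mul_nonneg (mul_nonneg (hw0 n) (hg0 n)) (sub_nonneg.2 (hgM n))])
  have h1 : Tendsto (fun n => Real.sqrt (g n ^ 2)) atTop (𝓝 0) := by
    have := (Real.continuous_sqrt.tendsto 0).comp (by simpa using h0.neg :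
      Tendsto (fun n => g n ^ 2) atTop (𝓝 0))
    simpa [Function.comp_def] using this
  simpa [Real.sqrt_sq (hg0 _)] using h1

end Sequences

/-! ### The one-shot deviation principle -/

namespace StochGame

section OneShot

variable {ι S : Type*} {A : ι → Type*} [Fintype S]

/-- Payoff of player `i` in the auxiliary game at `s` with continuation payoffs `v`, as a function
of the pure action profile. -/
def auxReward (G : StochGame ι S A) (δ : ℝ) (i : ι) (s : S) (v : S → ℝ) (a : ∀ j, A j) : ℝ :=
  (1 - δ) * G.r i s a + δ * ∑ t, (G.P s a : S → ℝ) t * v t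

theorem coe_mem_stdSimplex {X : Type*} [Fintype X] (p : stdSimplex ℝ X) :
    (p : X → ℝ) ∈ stdSimplex ℝ X := p.2

theorem abs_average_le {p : S → ℝ} (hp : p ∈ stdSimplex ℝ S) {v : S → ℝ} {M : ℝ}
    (hv : ∀ t, |v t| ≤ M) : |∑ t, p t * v t| ≤ M := by
  refine (Finset.abs_sum_le_sum_abs _ _).trans ?_
  calc ∑ t, |p t * v t| ≤ ∑ t, p t * M := Finset.sum_le_sum fun t _ => by
        rw [abs_mul, abs_of_nonneg (hp.1 t)]
        exact mul_le_mul_of_nonneg_left (hv t) (hp.1 t)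
    _ = M := by rw [← Finset.sum_mul, hp.2, one_mul]

theorem average_mono {p : S → ℝ} (hp : p ∈ stdSimplex ℝ S) {v v' : S → ℝ}
    (hv : ∀ t, v t ≤ v' t) : ∑ t, p t * v t ≤ ∑ t, p t * v' t :=
  Finset.sum_le_sum fun t _ => mul_le_mul_of_nonneg_left (hv t) (hp.1 t)

theorem average_add_const {p : S → ℝ} (hp : p ∈ stdSimplex ℝ S) (v : S → ℝ) (c : ℝ) :
    ∑ t, p t * (v t + c) = ∑ t, p t * v t + c := by
  simp only [mul_add, Finset.sum_add_distrib, ← Finset.sum_mul, hp.2, one_mul]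

theorem auxReward_mono (G : StochGame ι S A) {δ : ℝ} (hδ : 0 ≤ δ) (i : ι) (s : S) {v v' : S → ℝ}
    (hv : ∀ t, v t ≤ v' t) (a : ∀ j, A j) : G.auxReward δ i s v a ≤ G.auxReward δ i s v' a := by
  have := mul_le_mul_of_nonneg_left (average_mono (coe_mem_stdSimplex (G.P s a)) hv) hδ
  simp only [auxReward]
  linarith

theorem auxReward_add_const (G : StochGame ι S A) (δ : ℝ) (i : ι) (s : S) (v : S → ℝ) (c : ℝ)
    (a : ∀ j, A j) :
    G.auxReward δ i s (fun t => v t + c) a = G.auxReward δ i s v a + δ * c := by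
  simp only [auxReward, average_add_const (coe_mem_stdSimplex (G.P s a))]
  ring

theorem IdenticalInterest.auxReward_eq {G : StochGame ι S A} (hG : G.IdenticalInterest) (δ : ℝ)
    (i j : ι) (s : S) (v : S → ℝ) : G.auxReward δ i s v = G.auxReward δ j s v := by
  obtain ⟨r, hr⟩ := hG
  funext a
  simp [auxReward, hr]

theorem abs_auxReward_le (G : StochGame ι S A) {δ : ℝ} (hδ0 : 0 < δ) (hδ1 : δ < 1) {M : ℝ}
    {i : ι} (hr : ∀ s a, |G.r i s a| ≤ M) {v : S → ℝ} (hv : ∀ t, |v t| ≤ M) (s : S)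
    (a : ∀ j, A j) : |G.auxReward δ i s v a| ≤ M := by
  have h1 := abs_le.1 (hr s a)
  have h2 := abs_le.1 (abs_average_le (coe_mem_stdSimplex (G.P s a)) hv)
  rw [abs_le, auxReward]
  constructor <;> nlinarith

theorem abs_le_one_of_mem_stdSimplex {X : Type*} [Fintype X] {p : X → ℝ}
    (hp : p ∈ stdSimplex ℝ X) (b : X) : |p b| ≤ 1 := by
  rw [abs_of_nonneg (hp.1 b), ← hp.2]
  exact Finset.single_le_sum (fun c _ => hp.1 c) (Finset.mem_univ b)

theorem abs_sub_le_one_of_mem_stdSimplex {X : Type*} [Fintype X] {p q : X → ℝ}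
    (hp : p ∈ stdSimplex ℝ X) (hq : q ∈ stdSimplex ℝ X) (b : X) : |(p - q) b| ≤ 1 := by
  have h1 := (abs_le.1 (abs_le_one_of_mem_stdSimplex hp b)).2
  have h2 := (abs_le.1 (abs_le_one_of_mem_stdSimplex hq b)).2
  have h3 := hp.1 b
  have h4 := hq.1 b
  rw [Pi.sub_apply, abs_le]
  constructor <;> linarith

variable [Fintype ι] [DecidableEq ι] [∀ i, Fintype (A i)]

theorem aux_eq_mixedExt (G : StochGame ι S A) (δ : ℝ) (i : ι) (s : S) (v : S → ℝ)
    (y : ∀ j, A j → ℝ) : G.aux δ i s v y = mixedExt (G.auxReward δ i s v) y :=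
  (mixedExt_apply _ _).symm

theorem IdenticalInterest.aux_eq {G : StochGame ι S A} (hG : G.IdenticalInterest) (δ : ℝ)
    (i j : ι) (s : S) (v : S → ℝ) (y : ∀ j, A j → ℝ) : G.aux δ i s v y = G.aux δ j s v y := by
  rw [aux_eq_mixedExt, aux_eq_mixedExt, hG.auxReward_eq]

theorem expReward_zero (G : StochGame ι S A) (σ : ∀ j, BehavioralStrategy S A j) (i : ι)
    (h : List (S × (∀ j, A j))) (s : S) :
    G.expReward σ i 0 h s = mixedExt (G.r i s) (fun j => (σ j h s : A j → ℝ)) := by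
  rw [mixedExt_apply, expReward]

theorem expReward_succ (G : StochGame ι S A) (σ : ∀ j, BehavioralStrategy S A j) (i : ι) (k : ℕ)
    (h : List (S × (∀ j, A j))) (s : S) :
    G.expReward σ i (k + 1) h s = mixedExt (fun a =>
      ∑ t, (G.P s a : S → ℝ) t * G.expReward σ i k (h ++ [(s, a)]) t)
      (fun j => (σ j h s : A j → ℝ)) := by
  rw [mixedExt_apply, expReward]

theorem abs_expReward_le (G : StochGame ι S A) (σ : ∀ j, BehavioralStrategy S A j) (i : ι) {R : ℝ}
    (hR : ∀ s a, |G.r i s a| ≤ R) (k : ℕ) (h : List (S × (∀ j, A j))) (s : S) :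
    |G.expReward σ i k h s| ≤ R := by
  induction k generalizing h s with
  | zero =>
    rw [expReward_zero]
    exact abs_mixedExt_le (hR s) fun j => coe_mem_stdSimplex (σ j h s)
  | succ k ih =>
    rw [expReward_succ]
    exact abs_mixedExt_le (fun a => abs_average_le (coe_mem_stdSimplex (G.P s a)) fun t => ih _ _)
      fun j => coe_mem_stdSimplex (σ j h s)

/-- Expected discounted payoff collected during the first `K` stages. -/
def truncPayoff (G : StochGame ι S A) (δ : ℝ) (σ : ∀ j, BehavioralStrategy S A j) (i : ι) (K : ℕ)
    (h : List (S × (∀ j, A j))) (s : S) : ℝ :=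
  (1 - δ) * ∑ k ∈ Finset.range K, δ ^ k * G.expReward σ i k h s

/-- Bellman recursion for truncated payoffs. -/
theorem truncPayoff_succ (G : StochGame ι S A) (δ : ℝ) (σ : ∀ j, BehavioralStrategy S A j) (i : ι)
    (K : ℕ) (h : List (S × (∀ j, A j))) (s : S) :
    G.truncPayoff δ σ i (K + 1) h s = mixedExt (fun a =>
      G.auxReward δ i s (G.truncPayoff δ σ i K (h ++ [(s, a)])) a)
      (fun j => (σ j h s : A j → ℝ)) := by
  simp only [truncPayoff, auxReward]
  rw [Finset.sum_range_succ', expReward_zero]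
  simp only [expReward_succ, mixedExt_apply, pow_zero, one_mul, mul_add, Finset.mul_sum,
    Finset.sum_add_distrib]
  rw [add_comm]
  congr 1
  · exact Finset.sum_congr rfl fun a _ => by ring
  · rw [Finset.sum_comm]
    refine Finset.sum_congr rfl fun a _ => ?_
    rw [Finset.sum_comm]
    exact Finset.sum_congr rfl fun t _ => Finset.sum_congr rfl fun k _ => by ring

theorem tendsto_truncPayoff (G : StochGame ι S A) {δ : ℝ} (hδ0 : 0 < δ) (hδ1 : δ < 1)
    (σ : ∀ j, BehavioralStrategy S A j) (i : ι) (s : S) :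
    Tendsto (fun K => G.truncPayoff δ σ i K [] s) atTop (𝓝 (G.payoff δ σ i s)) := by
  obtain ⟨R, hR⟩ : ∃ R, ∀ s a, |G.r i s a| ≤ R := by
    obtain ⟨R, hR⟩ := (Set.finite_range fun p : S × (∀ j, A j) => |G.r i p.1 p.2|).bddAbove
    exact ⟨R, fun s a => hR ⟨(s, a), rfl⟩⟩
  have hs : Summable fun k => δ ^ k * G.expReward σ i k [] s := by
    refine ((summable_geometric_of_lt_one hδ0.le hδ1).mul_right R).of_norm_bounded fun k => ?_
    rw [Real.norm_eq_abs, abs_mul, abs_of_pos (pow_pos hδ0 k)]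
    exact mul_le_mul_of_nonneg_left (G.abs_expReward_le σ i hR k _ _) (pow_pos hδ0 k).le
  exact hs.hasSum.tendsto_sum_nat.const_mul _

/-- If no step of the play improves on `Φ` in the auxiliary games with continuation `Φ`, then the
payoff is at most `Φ`. -/
theorem payoff_le_of_aux_le (G : StochGame ι S A) {δ : ℝ} (hδ0 : 0 < δ) (hδ1 : δ < 1)
    (σ : ∀ j, BehavioralStrategy S A j) (i : ι) (Φ : S → ℝ)
    (hΦ : ∀ h s, G.aux δ i s Φ (fun j => (σ j h s : A j → ℝ)) ≤ Φ s) (s : S) :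
    G.payoff δ σ i s ≤ Φ s := by
  obtain ⟨M, hM⟩ : ∃ M, ∀ s, -M ≤ Φ s := by
    obtain ⟨M, hM⟩ := (Set.finite_range Φ).bddBelow
    exact ⟨-M, fun s => by simpa using hM ⟨s, rfl⟩⟩
  have key : ∀ K h s, G.truncPayoff δ σ i K h s ≤ Φ s + δ ^ K * M := by
    intro K
    induction K with
    | zero =>
      intro h s
      have := hM s
      simp only [truncPayoff, Finset.range_zero, Finset.sum_empty, mul_zero, pow_zero, one_mul]
      linarith
    | succ K ih =>
      intro h s
      rw [truncPayoff_succ]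
      have hy := fun j => coe_mem_stdSimplex (σ j h s)
      refine (mixedExt_mono (fun a => (G.auxReward_mono hδ0.le i s (ih _) a).trans_eq
        (G.auxReward_add_const δ i s Φ _ a)) hy).trans ?_
      rw [mixedExt_add_const _ _ hy, ← aux_eq_mixedExt]
      have := hΦ h s
      rw [pow_succ']
      linarith
  have hlim : Tendsto (fun K => Φ s + δ ^ K * M) atTop (𝓝 (Φ s)) := by
    simpa using ((tendsto_pow_atTop_nhds_zero_of_lt_one hδ0.le hδ1).mul_const M).const_add (Φ s)
  exact le_of_tendsto_of_tendsto' (G.tendsto_truncPayoff hδ0 hδ1 σ i s) hlim fun K => key K [] s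

theorem le_payoff_of_le_aux (G : StochGame ι S A) {δ : ℝ} (hδ0 : 0 < δ) (hδ1 : δ < 1)
    (σ : ∀ j, BehavioralStrategy S A j) (i : ι) (Φ : S → ℝ)
    (hΦ : ∀ h s, Φ s ≤ G.aux δ i s Φ (fun j => (σ j h s : A j → ℝ))) (s : S) :
    Φ s ≤ G.payoff δ σ i s := by
  obtain ⟨M, hM⟩ : ∃ M, ∀ s, Φ s ≤ M := by
    obtain ⟨M, hM⟩ := (Set.finite_range Φ).bddAbove
    exact ⟨M, fun s => hM ⟨s, rfl⟩⟩
  have key : ∀ K h s, Φ s + -(δ ^ K * M) ≤ G.truncPayoff δ σ i K h s := by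
    intro K
    induction K with
    | zero =>
      intro h s
      have := hM s
      simp only [truncPayoff, Finset.range_zero, Finset.sum_empty, mul_zero, pow_zero, one_mul]
      linarith
    | succ K ih =>
      intro h s
      rw [truncPayoff_succ]
      have hy := fun j => coe_mem_stdSimplex (σ j h s)
      refine le_trans ?_ (mixedExt_mono (fun a => (G.auxReward_add_const δ i s Φ _ a).symm.trans_le
        (G.auxReward_mono hδ0.le i s (ih _) a)) hy)
      rw [mixedExt_add_const _ _ hy, ← aux_eq_mixedExt]
      have := hΦ h s
      rw [pow_succ']
      linarith
  have hlim : Tendsto (fun K => Φ s + -(δ ^ K * M)) atTop (𝓝 (Φ s)) := by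
    simpa using
      ((tendsto_pow_atTop_nhds_zero_of_lt_one hδ0.le hδ1).mul_const M).neg.const_add (Φ s)
  exact le_of_tendsto_of_tendsto' hlim (G.tendsto_truncPayoff hδ0 hδ1 σ i s) fun K => key K [] s

variable [∀ i, DecidableEq (A i)]

/-- A stationary profile whose restriction to each state is an equilibrium, with payoff `Φ`, of the
auxiliary game with continuation payoffs `Φ` is a Nash equilibrium with payoff `Φ`. -/
theorem mem_stationaryNashWithPayoff (G : StochGame ι S A) {δ : ℝ} (hδ0 : 0 < δ) (hδ1 : δ < 1)
    (x : StationaryProfile S A) (Φ : ι → S → ℝ)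
    (hval : ∀ i s, G.aux δ i s (Φ i) (atState x s) = Φ i s)
    (hdev : ∀ i s b,
      G.aux δ i s (Φ i) (Function.update (atState x s) i (Pi.single b 1)) ≤ Φ i s) :
    x ∈ G.stationaryNashWithPayoff δ Φ := by
  have hpay : ∀ i s, G.payoff δ x.toBehavioral i s = Φ i s := fun i s =>
    le_antisymm (G.payoff_le_of_aux_le hδ0 hδ1 _ i (Φ i) (fun _ s => (hval i s).le) s)
      (G.le_payoff_of_le_aux hδ0 hδ1 _ i (Φ i) (fun _ s => (hval i s).ge) s)
  refine ⟨fun i τ s => ?_, hpay⟩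
  rw [hpay]
  refine G.payoff_le_of_aux_le hδ0 hδ1 _ i (Φ i) (fun h s => ?_) s
  have hupd : (fun j => ((Function.update x.toBehavioral i τ : ∀ j, BehavioralStrategy S A j)
      j h s : A j → ℝ)) = Function.update (atState x s) i (τ h s : A i → ℝ) := by
    ext j : 1
    by_cases hj : j = i
    · subst hj
      simp
    · simp [hj, atState, StationaryProfile.toBehavioral]
  rw [hupd, aux_eq_mixedExt, mixedExt_update_eq_sum]
  calc ∑ b, (τ h s : A i → ℝ) b * _ ≤ ∑ b, (τ h s : A i → ℝ) b * Φ i s :=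
        average_mono (coe_mem_stdSimplex (τ h s)) fun b => by
          rw [← aux_eq_mixedExt]
          exact hdev i s b
    _ = Φ i s := by rw [← Finset.sum_mul, (coe_mem_stdSimplex (τ h s)).2, one_mul]

end OneShot

end StochGame

/-! ### Convergence of weighted fictitious play -/

namespace StochGame

/-- In a compact space, a sequence approaches every set that contains its subsequential limits. -/
theorem convergesToSet_of_subseq {X : Type*} [PseudoMetricSpace X] [CompactSpace X] {x : ℕ → X}
    {E : Set X} (h : ∀ (φ : ℕ → ℕ) (y : X), StrictMono φ → Tendsto (x ∘ φ) atTop (𝓝 y) → y ∈ E) :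
    ConvergesToSet x E := by
  intro ε hε
  by_contra! hcon
  obtain ⟨φ, hφ, hfar⟩ := extraction_of_frequently_atTop
    (frequently_atTop.2 hcon : ∃ᶠ n in atTop, ∀ y ∈ E, ε ≤ dist (x n) y)
  obtain ⟨y, ψ, hψ, hy⟩ := CompactSpace.tendsto_subseq (x ∘ φ)
  have hyE := h (φ ∘ ψ) y (hφ.comp hψ) hy
  obtain ⟨n, hn⟩ := ((Metric.tendsto_nhds.1 hy) ε hε).exists
  exact (hfar (ψ n) y hyE).not_gt hn

theorem ConvergesToSet.mono {X : Type*} [PseudoMetricSpace X] {x : ℕ → X} {E F : Set X}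
    (h : ConvergesToSet x E) (hEF : E ⊆ F) : ConvergesToSet x F := fun ε hε =>
  let ⟨N, hN⟩ := h ε hε
  ⟨N, fun n hn => let ⟨y, hy, hd⟩ := hN n hn; ⟨y, hEF hy, hd⟩⟩

section Weighted

variable {ι S : Type*} {A : ι → Type*} [∀ i, Fintype (A i)]

theorem continuous_atState (s : S) :
    Continuous fun x : StationaryProfile S A => atState x s :=
  continuous_pi fun j => continuous_subtype_val.comp ((continuous_apply s).comp (continuous_apply j))

theorem tendsto_aux [Fintype ι] [DecidableEq ι] [Fintype S] (G : StochGame ι S A) (δ : ℝ) (i : ι)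
    (s : S) {v : ℕ → S → ℝ} {y : ℕ → ∀ j, A j → ℝ} {v' : S → ℝ} {y' : ∀ j, A j → ℝ}
    (hv : Tendsto v atTop (𝓝 v')) (hy : Tendsto y atTop (𝓝 y')) :
    Tendsto (fun n => G.aux δ i s (v n) (y n)) atTop (𝓝 (G.aux δ i s v' y')) := by
  have hv' := tendsto_pi_nhds.1 hv
  have hy' : ∀ j b, Tendsto (fun n => y n j b) atTop (𝓝 (y' j b)) := fun j =>
    tendsto_pi_nhds.1 (tendsto_pi_nhds.1 hy j)
  exact tendsto_finsetSum _ fun a _ => (tendsto_finsetProd _ fun j _ => hy' j _).mul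
    (((tendsto_finsetSum _ fun t _ => (hv' t).const_mul _).const_mul _).const_add _)

variable [Fintype ι] [DecidableEq ι] [Fintype S] [∀ i, DecidableEq (A i)]

/-- A common form of the synchronous and the asynchronous procedure: at stage `n` the continuation
estimates move with step `γ n`, and the empirical actions in state `s` move with step `w n s`
towards a profile `b n s` of best responses (no condition on `b n s` when `w n s = 0`). -/
structure IsWeightedFP (G : StochGame ι S A) (δ : ℝ) (γ : ℕ → ℝ) (w : ℕ → S → ℝ)
    (b : ℕ → S → (∀ i, A i)) (x : ℕ → StationaryProfile S A) (u : ℕ → ι → S → ℝ) : Prop where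
  γ_nonneg : ∀ n, 0 ≤ γ n
  γ_le_one : ∀ n, γ n ≤ 1
  γ_diverge : ¬ Summable γ
  w_nonneg : ∀ n s, 0 ≤ w n s
  w_le_one : ∀ n s, w n s ≤ 1
  w_diverge : ∀ s, ¬ Summable fun n => w n s
  w_sq : ∀ s, Summable fun n => w n s ^ 2
  init : ∀ i j, u 0 i = u 0 j
  payoff_update : ∀ n i s,
    u (n + 1) i s - u n i s = γ n * (G.aux δ i s (u n i) (atState (x n) s) - u n i s)
  action_update : ∀ n i s, (x (n + 1) i s : A i → ℝ) - (x n i s : A i → ℝ) =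
    w n s • (Pi.single (b n s i) 1 - (x n i s : A i → ℝ))
  best_response : ∀ n i s, w n s ≠ 0 → b n s i ∈ G.bestResponse δ i s (u n i) (x n)

namespace IsWeightedFP

variable {G : StochGame ι S A} {δ : ℝ} {γ : ℕ → ℝ} {w : ℕ → S → ℝ}
  {b : ℕ → S → (∀ i, A i)} {x : ℕ → StationaryProfile S A} {u : ℕ → ι → S → ℝ}

theorem common (h : G.IsWeightedFP δ γ w b x u) (hG : G.IdenticalInterest) (n : ℕ) (i j : ι) :
    u n i = u n j := by
  induction n with
  | zero => exact h.init i j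
  | succ n ih =>
    funext s
    have h1 := h.payoff_update n i s
    have h2 := h.payoff_update n j s
    rw [ih, hG.aux_eq δ i j] at h1
    linarith

/-- The estimates remain bounded, as `u (n + 1)` is a convex combination of `u n` and of averages of
rewards and of `u n`. -/
theorem exists_bound (h : G.IsWeightedFP δ γ w b x u) (hδ0 : 0 < δ) (hδ1 : δ < 1) (p : ι) :
    ∃ M, 0 ≤ M ∧ (∀ n s, |u n p s| ≤ M) ∧ ∀ n s a, |G.auxReward δ p s (u n p) a| ≤ M := by
  obtain ⟨R, hR⟩ := (Set.finite_range fun q : S × (∀ j, A j) => |G.r p q.1 q.2|).bddAbove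
  obtain ⟨U, hU⟩ := (Set.finite_range fun s => |u 0 p s|).bddAbove
  set M := max 0 (max R U)
  have hr : ∀ s a, |G.r p s a| ≤ M := fun s a =>
    (hR ⟨(s, a), rfl⟩).trans ((le_max_left _ _).trans (le_max_right _ _))
  have hu : ∀ n s, |u n p s| ≤ M := by
    intro n
    induction n with
    | zero => exact fun s => (hU ⟨s, rfl⟩).trans ((le_max_right _ _).trans (le_max_right _ _))
    | succ n ih =>
      intro s
      have h1 := h.payoff_update n p s
      rw [aux_eq_mixedExt] at h1
      have h2 := abs_le.1 (abs_mixedExt_le (fun a => abs_auxReward_le G hδ0 hδ1 hr ih s a)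
        (fun j => coe_mem_stdSimplex (x n j s)) : |mixedExt _ (atState (x n) s)| ≤ M)
      have h3 := abs_le.1 (ih s)
      have h4 := h.γ_nonneg n
      have h5 := h.γ_le_one n
      rw [abs_le]
      constructor <;> nlinarith
  exact ⟨M, le_max_left _ _, hu, fun n => abs_auxReward_le G hδ0 hδ1 hr (hu n)⟩

/-- The multilinear common payoff of the auxiliary game in state `s` at stage `n`. The rewards and the
estimates are read off the player `p`; under identical interest the choice of `p` is immaterial. -/
def stagePayoff (G : StochGame ι S A) (δ : ℝ) (u : ℕ → ι → S → ℝ) (p : ι) (n : ℕ) (s : S) :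
    MultilinearMap ℝ (fun j => A j → ℝ) ℝ :=
  mixedExt (G.auxReward δ p s (u n p))

/-- The excess of the payoff of the current profile in the auxiliary game over the current
continuation estimate. -/
def excess (G : StochGame ι S A) (δ : ℝ) (x : ℕ → StationaryProfile S A) (u : ℕ → ι → S → ℝ)
    (p : ι) (n : ℕ) (s : S) : ℝ :=
  stagePayoff G δ u p n s (atState (x n) s) - u n p s

/-- What player `i` gains in the auxiliary game by deviating to the pure action `c`. -/
def gain (G : StochGame ι S A) (δ : ℝ) (x : ℕ → StationaryProfile S A) (u : ℕ → ι → S → ℝ)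
    (p : ι) (n : ℕ) (s : S) (i : ι) (c : A i) : ℝ :=
  stagePayoff G δ u p n s (Function.update (atState (x n) s) i (Pi.single c 1)) -
    stagePayoff G δ u p n s (atState (x n) s)

/-- The total gain of the best responses towards which the profile moves. -/
def totalGain (G : StochGame ι S A) (δ : ℝ) (b : ℕ → S → (∀ i, A i))
    (x : ℕ → StationaryProfile S A) (u : ℕ → ι → S → ℝ) (p : ι) (n : ℕ) (s : S) : ℝ :=
  ∑ j, gain G δ x u p n s j (b n s j)

theorem gain_le_gain (h : G.IsWeightedFP δ γ w b x u) (hG : G.IdenticalInterest) (p : ι) {n : ℕ}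
    {s : S} (hw : w n s ≠ 0) (i : ι) (c : A i) :
    gain G δ x u p n s i c ≤ gain G δ x u p n s i (b n s i) := by
  have := h.best_response n i s hw c
  rw [hG.aux_eq δ i p, hG.aux_eq δ i p, h.common hG n i p, aux_eq_mixedExt, aux_eq_mixedExt] at this
  simpa only [gain, stagePayoff, sub_le_sub_iff_right] using this

/-- The current mixed action is an average of pure actions, so a best one does at least as well. -/
theorem gain_nonneg (h : G.IsWeightedFP δ γ w b x u) (hG : G.IdenticalInterest) (p : ι) {n : ℕ}
    {s : S} (hw : w n s ≠ 0) (i : ι) : 0 ≤ gain G δ x u p n s i (b n s i) := by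
  have havg : ∑ c, (x n i s : A i → ℝ) c * gain G δ x u p n s i c = 0 := by
    have := mixedExt_update_eq_sum (G.auxReward δ p s (u n p)) (atState (x n) s) i
      (atState (x n) s i)
    rw [Function.update_eq_self] at this
    simp only [gain, mul_sub, Finset.sum_sub_distrib, ← Finset.sum_mul,
      (coe_mem_stdSimplex (x n i s)).2, stagePayoff, one_mul]
    exact sub_eq_zero.2 this.symm
  have := average_mono (coe_mem_stdSimplex (x n i s)) fun c => h.gain_le_gain hG p hw i c
  rwa [havg, ← Finset.sum_mul, (coe_mem_stdSimplex (x n i s)).2, one_mul] at this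

theorem mul_totalGain_nonneg (h : G.IsWeightedFP δ γ w b x u) (hG : G.IdenticalInterest) (p : ι)
    (n : ℕ) (s : S) : 0 ≤ w n s * totalGain G δ b x u p n s := by
  by_cases hw : w n s = 0
  · simp [hw]
  · exact mul_nonneg (h.w_nonneg n s) (Finset.sum_nonneg fun i _ => h.gain_nonneg hG p hw i)

theorem mul_gain_le (h : G.IsWeightedFP δ γ w b x u) (hG : G.IdenticalInterest) (p : ι)
    (n : ℕ) (s : S) (i : ι) (c : A i) :
    w n s * max (gain G δ x u p n s i c) 0 ≤ w n s * totalGain G δ b x u p n s := by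
  by_cases hw : w n s = 0
  · simp [hw]
  · refine mul_le_mul_of_nonneg_left ?_ (h.w_nonneg n s)
    have h1 : gain G δ x u p n s i (b n s i) ≤ totalGain G δ b x u p n s :=
      Finset.single_le_sum (f := fun j => gain G δ x u p n s j (b n s j))
        (fun j _ => h.gain_nonneg hG p hw j) (Finset.mem_univ i)
    exact max_le ((h.gain_le_gain hG p hw i c).trans h1) ((h.gain_nonneg hG p hw i).trans h1)

theorem atState_succ (h : G.IsWeightedFP δ γ w b x u) (n : ℕ) (s : S) :
    atState (x (n + 1)) s = atState (x n) s +
      w n s • ((fun j => Pi.single (b n s j) 1) - atState (x n) s) := by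
  ext j : 1
  have := h.action_update n j s
  rw [sub_eq_iff_eq_add'] at this
  exact this

theorem payoff_succ (h : G.IsWeightedFP δ γ w b x u) (p : ι) (n : ℕ) (s : S) :
    u (n + 1) p s = u n p s + γ n * excess G δ x u p n s := by
  have := h.payoff_update n p s
  rw [aux_eq_mixedExt] at this
  rw [excess, stagePayoff]
  linarith

/-- The excess decreases by at most the effect of the continuation estimates, up to the second order
error of the expansion of the payoff; the gains of the players make it increase. -/
theorem le_excess_succ (h : G.IsWeightedFP δ γ w b x u) (hδ0 : 0 < δ)
    (p : ι) {M : ℝ} (hM : ∀ n s a, |G.auxReward δ p s (u n p) a| ≤ M)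
    {n : ℕ} {m : ℝ} (hm : ∀ s, -m ≤ excess G δ x u p n s) (s : S) :
    (1 - γ n) * excess G δ x u p n s - δ * γ n * m + w n s * totalGain G δ b x u p n s -
      Fintype.card (Finset ι) * (Fintype.card (∀ j, A j) * M) * w n s ^ 2 ≤
      excess G δ x u p (n + 1) s := by
  have h1 : stagePayoff G δ u p n s (atState (x (n + 1)) s) + δ * -(γ n * m) ≤
      stagePayoff G δ u p (n + 1) s (atState (x (n + 1)) s) := by
    have hy : ∀ j, atState (x (n + 1)) s j ∈ stdSimplex ℝ (A j) :=
      fun j => coe_mem_stdSimplex (x (n + 1) j s)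
    rw [stagePayoff, ← mixedExt_add_const _ _ hy]
    refine mixedExt_mono (fun a => ?_) hy
    rw [← auxReward_add_const]
    refine G.auxReward_mono hδ0.le p s (fun t => ?_) a
    rw [h.payoff_succ]
    nlinarith [mul_le_mul_of_nonneg_left (hm t) (h.γ_nonneg n)]
  have h2 := le_mixedExt_add_smul (hM n s) (y := atState (x n) s)
    (a := fun j => Pi.single (b n s j) 1)
    (fun j => abs_le_one_of_mem_stdSimplex (coe_mem_stdSimplex (x n j s)))
    (fun j => abs_sub_le_one_of_mem_stdSimplex (single_mem_stdSimplex ℝ (b n s j))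
      (coe_mem_stdSimplex (x n j s))) (h.w_nonneg n s) (h.w_le_one n s)
  rw [← h.atState_succ] at h2
  have h3 := h.payoff_succ p n s
  simp only [excess, totalGain, gain, stagePayoff] at *
  linarith

theorem summable_sum_sq (h : G.IsWeightedFP δ γ w b x u) (C : ℝ) :
    Summable fun n => C * ∑ s, w n s ^ 2 :=
  (summable_sum fun s _ => h.w_sq s).mul_left C

/-- The norm of the negative part of the excess contracts, up to summable errors, at rate
`(1 - δ) * γ n`; hence it is summable against `γ`. -/
theorem exists_lower_bound (h : G.IsWeightedFP δ γ w b x u) (hG : G.IdenticalInterest)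
    (hδ0 : 0 < δ) (hδ1 : δ < 1) (p : ι) :
    ∃ m : ℕ → ℝ, (∀ n, 0 ≤ m n) ∧ (∀ n s, -m n ≤ excess G δ x u p n s) ∧
      Summable fun n => γ n * m n := by
  obtain ⟨M, hM0, -, hM⟩ := h.exists_bound hδ0 hδ1 p
  set C : ℝ := Fintype.card (Finset ι) * (Fintype.card (∀ j, A j) * M)
  have hC : 0 ≤ C := by positivity
  let m : ℕ → ℝ := fun n => ‖fun s => max (-excess G δ x u p n s) 0‖
  have hm0 : ∀ n, 0 ≤ m n := fun n => norm_nonneg _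
  have hm : ∀ n s, -m n ≤ excess G δ x u p n s := fun n s => by
    have := norm_le_pi_norm (fun s => max (-excess G δ x u p n s) 0) s
    rw [Real.norm_of_nonneg (le_max_right _ _)] at this
    exact neg_le.1 ((le_max_left _ _).trans this)
  have hstep : ∀ n, m (n + 1) ≤ (1 - (1 - δ) * γ n) * m n + C * ∑ s, w n s ^ 2 := fun n => by
    have hg0 := h.γ_nonneg n
    have hg1 := h.γ_le_one n
    have hsum : 0 ≤ ∑ s, w n s ^ 2 := Finset.sum_nonneg fun s _ => sq_nonneg _
    have hrhs : 0 ≤ (1 - (1 - δ) * γ n) * m n + C * ∑ s, w n s ^ 2 :=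
      add_nonneg (mul_nonneg (by nlinarith) (hm0 n)) (mul_nonneg hC hsum)
    refine (pi_norm_le_iff_of_nonneg hrhs).2 fun s => ?_
    rw [Real.norm_of_nonneg (le_max_right _ _)]
    refine max_le ?_ hrhs
    have h1 := h.le_excess_succ hδ0 p hM (hm n) s
    have h2 := h.mul_totalGain_nonneg hG p n s
    have h3 : w n s ^ 2 ≤ ∑ s, w n s ^ 2 :=
      Finset.single_le_sum (f := fun s => w n s ^ 2) (fun s _ => sq_nonneg _) (Finset.mem_univ s)
    have h4 := mul_le_mul_of_nonneg_left h3 hC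
    have h5 := mul_le_mul_of_nonneg_left (hm n s) (sub_nonneg.2 hg1)
    linarith
  refine ⟨m, hm0, hm, ?_⟩
  have hs : Summable fun n => (1 - δ) * (γ n * m n) := by
    refine summable_of_almost_increments (z := fun n => -m n) (M := 0)
      (fun n => neg_nonpos.2 (hm0 n))
      (fun n => mul_nonneg (sub_nonneg.2 hδ1.le) (mul_nonneg (h.γ_nonneg n) (hm0 n)))
      (h.summable_sum_sq C) (fun n => mul_nonneg hC (Finset.sum_nonneg fun s _ => sq_nonneg _))
      fun n => ?_
    linarith [hstep n]
  exact (summable_mul_left_iff (sub_pos.2 hδ1).ne').1 hs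

/-- The continuation estimates converge, as they are bounded and increase up to summable errors;
their total variation is finite. -/
theorem summable_excess (h : G.IsWeightedFP δ γ w b x u) (hG : G.IdenticalInterest)
    (hδ0 : 0 < δ) (hδ1 : δ < 1) (p : ι) (s : S) :
    (∃ l, Tendsto (fun n => u n p s) atTop (𝓝 l)) ∧
      Summable fun n => γ n * |excess G δ x u p n s| := by
  obtain ⟨M, -, hu, -⟩ := h.exists_bound hδ0 hδ1 p
  obtain ⟨m, hm0, hm, hs⟩ := h.exists_lower_bound hG hδ0 hδ1 p
  have he0 : ∀ n, 0 ≤ γ n * m n := fun n => mul_nonneg (h.γ_nonneg n) (hm0 n)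
  have hp0 : ∀ n, 0 ≤ γ n * (excess G δ x u p n s + m n) := fun n =>
    mul_nonneg (h.γ_nonneg n) (by linarith [hm n s])
  have hstep : ∀ n, u n p s + γ n * (excess G δ x u p n s + m n) - γ n * m n ≤ u (n + 1) p s :=
    fun n => by linarith [h.payoff_succ p n s]
  have hpos := summable_of_almost_increments (fun n => le_of_abs_le (hu n s)) hp0 hs he0 hstep
  refine ⟨exists_tendsto_of_almost_monotone (fun n => le_of_abs_le (hu n s)) hs he0
    fun n => by linarith [hstep n, hp0 n], ?_⟩
  refine (hpos.add hs).of_nonneg_of_le (fun n => mul_nonneg (h.γ_nonneg n) (abs_nonneg _))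
    fun n => ?_
  rw [← mul_add]
  refine mul_le_mul_of_nonneg_left (abs_le.2 ⟨?_, ?_⟩) (h.γ_nonneg n) <;>
    linarith [hm n s, hm0 n]

/-- The excess tends to zero, and the gains are summable against the weights `w`. -/
theorem tendsto_excess (h : G.IsWeightedFP δ γ w b x u) (hG : G.IdenticalInterest)
    (hδ0 : 0 < δ) (hδ1 : δ < 1) (p : ι) (s : S) :
    Tendsto (fun n => excess G δ x u p n s) atTop (𝓝 0) ∧
      Summable fun n => w n s * totalGain G δ b x u p n s := by
  obtain ⟨M, hM0, hu, hM⟩ := h.exists_bound hδ0 hδ1 p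
  obtain ⟨m, hm0, hm, hs⟩ := h.exists_lower_bound hG hδ0 hδ1 p
  obtain ⟨-, hD⟩ := h.summable_excess hG hδ0 hδ1 p s
  set C : ℝ := Fintype.card (Finset ι) * (Fintype.card (∀ j, A j) * M)
  have hC : 0 ≤ C := by positivity
  have hbound : ∀ n, excess G δ x u p n s ≤ 2 * M := fun n => by
    have h1 := le_of_abs_le (abs_mixedExt_le (hM n s) (fun j => coe_mem_stdSimplex (x n j s)) :
      |mixedExt _ (atState (x n) s)| ≤ M)
    have h2 := neg_le_of_abs_le (hu n s)
    rw [excess, stagePayoff]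
    linarith
  have herr : Summable fun n =>
      γ n * |excess G δ x u p n s| + δ * (γ n * m n) + C * w n s ^ 2 :=
    (hD.add (hs.mul_left δ)).add ((h.w_sq s).mul_left C)
  have herr0 : ∀ n, 0 ≤ γ n * |excess G δ x u p n s| + δ * (γ n * m n) + C * w n s ^ 2 :=
    fun n => by
      have := h.γ_nonneg n
      have := hm0 n
      positivity
  have hstep : ∀ n, excess G δ x u p n s + w n s * totalGain G δ b x u p n s -
      (γ n * |excess G δ x u p n s| + δ * (γ n * m n) + C * w n s ^ 2) ≤
      excess G δ x u p (n + 1) s := fun n => by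
    have h1 := h.le_excess_succ hδ0 p hM (hm n) s
    have h2 := mul_le_mul_of_nonneg_left (le_abs_self (excess G δ x u p n s)) (h.γ_nonneg n)
    linarith
  have hg0 := h.mul_totalGain_nonneg hG p
  obtain ⟨l, hl⟩ := exists_tendsto_of_almost_monotone hbound herr herr0
    fun n => by linarith [hstep n, hg0 n s]
  exact ⟨tendsto_zero_of_summable_mul hl h.γ_nonneg h.γ_diverge hD,
    summable_of_almost_increments hbound (fun n => hg0 n s) herr herr0 hstep⟩

/-- The payoff of a profile that moves by `w n s • d` changes at most by a multiple of `w n s`, up to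
the variation of the continuation estimates. -/
theorem abs_stagePayoff_succ_sub_le (h : G.IsWeightedFP δ γ w b x u) (hδ0 : 0 < δ) (hδ1 : δ < 1)
    (p : ι) {M : ℝ} (hM : ∀ n s a, |G.auxReward δ p s (u n p) a| ≤ M) (n : ℕ) (s : S)
    {y y' d : ∀ j, A j → ℝ} (hy : ∀ j, y j ∈ stdSimplex ℝ (A j))
    (hy' : ∀ j, y' j ∈ stdSimplex ℝ (A j)) (hd : ∀ j c, |d j c| ≤ 1) (hyd : y' = y + w n s • d) :
    |stagePayoff G δ u p (n + 1) s y' - stagePayoff G δ u p n s y| ≤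
      Fintype.card (Finset ι) * (Fintype.card (∀ j, A j) * M) * w n s +
        ∑ t, γ n * |excess G δ x u p n t| := by
  have h1 := abs_mixedExt_add_smul_sub_le (hM n s)
    (fun j => abs_le_one_of_mem_stdSimplex (hy j)) hd (h.w_nonneg n s) (h.w_le_one n s)
  rw [← hyd] at h1
  have h2 : |mixedExt (G.auxReward δ p s (u (n + 1) p)) y' -
      mixedExt (G.auxReward δ p s (u n p)) y'| ≤ ∑ t, γ n * |excess G δ x u p n t| := by
    rw [mixedExt_sub]
    refine abs_mixedExt_le (fun a => ?_) hy'
    have h3 : G.auxReward δ p s (u (n + 1) p) a - G.auxReward δ p s (u n p) a =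
        δ * ∑ t, (G.P s a : S → ℝ) t * (γ n * excess G δ x u p n t) := by
      simp only [auxReward, h.payoff_succ p n, mul_add, Finset.sum_add_distrib]
      ring
    have h4 : |∑ t, (G.P s a : S → ℝ) t * (γ n * excess G δ x u p n t)| ≤
        ∑ t, γ n * |excess G δ x u p n t| := by
      refine abs_average_le (coe_mem_stdSimplex (G.P s a)) fun t => ?_
      rw [abs_mul, abs_of_nonneg (h.γ_nonneg n)]
      exact Finset.single_le_sum (f := fun t => γ n * |excess G δ x u p n t|)
        (fun t _ => mul_nonneg (h.γ_nonneg n) (abs_nonneg _)) (Finset.mem_univ t)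
    rw [h3, abs_mul, abs_of_pos hδ0]
    exact (mul_le_of_le_one_left (abs_nonneg _) hδ1.le).trans h4
  rw [stagePayoff, stagePayoff]
  rw [abs_le] at *
  constructor <;> linarith

/-- Asymptotically, no player gains by deviating to a pure action. -/
theorem tendsto_gain (h : G.IsWeightedFP δ γ w b x u) (hG : G.IdenticalInterest)
    (hδ0 : 0 < δ) (hδ1 : δ < 1) (p : ι) (s : S) (i : ι) (c : A i) :
    Tendsto (fun n => max (gain G δ x u p n s i c) 0) atTop (𝓝 0) := by
  obtain ⟨M, hM0, -, hM⟩ := h.exists_bound hδ0 hδ1 p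
  set C : ℝ := Fintype.card (Finset ι) * (Fintype.card (∀ j, A j) * M) with hCdef
  have hC : 0 ≤ C := by positivity
  have hx : ∀ n j, atState (x n) s j ∈ stdSimplex ℝ (A j) := fun n j => coe_mem_stdSimplex (x n j s)
  have hdev : ∀ n j, Function.update (atState (x n) s) i (Pi.single c 1) j ∈ stdSimplex ℝ (A j) := by
    intro n j
    by_cases hj : j = i
    · subst hj
      simpa using single_mem_stdSimplex ℝ c
    · simpa [hj] using hx n j
  have hbound : ∀ n, max (gain G δ x u p n s i c) 0 ≤ 2 * M := fun n => by
    have h1 := le_of_abs_le (abs_mixedExt_le (hM n s) (hdev n))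
    have h2 := neg_le_of_abs_le (abs_mixedExt_le (hM n s) (hx n))
    refine max_le ?_ (by linarith)
    rw [gain, stagePayoff]
    linarith
  have hd : ∀ n j c',
      |((fun j => Pi.single (b n s j) 1 : ∀ j, A j → ℝ) - atState (x n) s) j c'| ≤ 1 := fun n j =>
    abs_sub_le_one_of_mem_stdSimplex (single_mem_stdSimplex ℝ (b n s j)) (hx n j)
  refine tendsto_zero_of_slow_variation (w := fun n => w n s) (C := 2 * C)
    (e := fun n => 2 * ∑ t, γ n * |excess G δ x u p n t|)
    (fun n => le_max_right _ _) hbound (by positivity) (fun n => h.w_nonneg n s) (h.w_diverge s)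
    (h.w_sq s)
    (fun n => mul_nonneg zero_le_two
      (Finset.sum_nonneg fun t _ => mul_nonneg (h.γ_nonneg n) (abs_nonneg _)))
    ((summable_sum fun t _ => (h.summable_excess hG hδ0 hδ1 p t).2).mul_left 2)
    ((h.tendsto_excess hG hδ0 hδ1 p s).2.of_nonneg_of_le
      (fun n => mul_nonneg (h.w_nonneg n s) (le_max_right _ _))
      fun n => h.mul_gain_le hG p n s i c) fun n => ?_
  have hsucc := h.atState_succ n s
  have h1 := h.abs_stagePayoff_succ_sub_le hδ0 hδ1 p hM n s (hx n) (hx (n + 1)) (hd n) hsucc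
  -- the deviating player does not move, whence the zero in the direction of movement
  have h2 := h.abs_stagePayoff_succ_sub_le hδ0 hδ1 p hM n s (hdev n) (hdev (n + 1))
    (d := Function.update ((fun j => Pi.single (b n s j) 1) - atState (x n) s) i 0)
    (fun j c' => by
      by_cases hj : j = i
      · subst hj
        simp
      · rw [Function.update_of_ne hj]
        exact hd n j c')
    (by
      ext j : 1
      by_cases hj : j = i
      · subst hj
        simp
      · simp only [Function.update_of_ne hj, hsucc, Pi.add_apply, Pi.smul_apply])
  have h3 := (abs_le.1 h1).1
  have h4 := (abs_le.1 h2).2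
  have h5 : 0 ≤ ∑ t, γ n * |excess G δ x u p n t| :=
    Finset.sum_nonneg fun t _ => mul_nonneg (h.γ_nonneg n) (abs_nonneg _)
  have h6 := mul_nonneg hC (h.w_nonneg n s)
  have h7 := le_max_left (gain G δ x u p n s i c) 0
  have h8 := le_max_right (gain G δ x u p n s i c) 0
  rw [← hCdef] at h3 h4
  refine max_le ?_ (by linarith)
  simp only [gain] at *
  linarith

/-- Every limit point of the profiles is an equilibrium in each auxiliary game whose continuation
payoffs are the limit of the estimates. -/
theorem convergesToEquilibria (h : G.IsWeightedFP δ γ w b x u) (hG : G.IdenticalInterest)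
    (hδ0 : 0 < δ) (hδ1 : δ < 1) : G.ConvergesToEquilibria δ x u := by
  choose Φ hΦ using fun (i : ι) (s : S) => (h.summable_excess hG hδ0 hδ1 i s).1
  have hconv : ConvergesToSet x (G.stationaryNashWithPayoff δ Φ) := by
    refine convergesToSet_of_subseq fun φ y hφ hy => ?_
    have hu : ∀ i, Tendsto (fun n => u (φ n) i) atTop (𝓝 (Φ i)) := fun i =>
      tendsto_pi_nhds.2 fun s => (hΦ i s).comp hφ.tendsto_atTop
    have hx : ∀ s, Tendsto (fun n => atState (x (φ n)) s) atTop (𝓝 (atState y s)) := fun s =>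
      ((continuous_atState s).tendsto y).comp hy
    have hlim : ∀ i s, Tendsto (fun n => G.aux δ i s (u (φ n) i) (atState (x (φ n)) s)) atTop
        (𝓝 (G.aux δ i s (Φ i) (atState y s))) := fun i s =>
      G.tendsto_aux δ i s (hu i) (hx s)
    have hval : ∀ i s, G.aux δ i s (Φ i) (atState y s) = Φ i s := fun i s => by
      have h1 := (h.tendsto_excess hG hδ0 hδ1 i s).1.comp hφ.tendsto_atTop
      have h2 := (hlim i s).sub ((hΦ i s).comp hφ.tendsto_atTop)
      refine sub_eq_zero.1 (tendsto_nhds_unique h2 (h1.congr fun n => ?_))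
      simp [excess, stagePayoff, aux_eq_mixedExt]
    refine G.mem_stationaryNashWithPayoff hδ0 hδ1 y Φ hval fun i s c => ?_
    have h1 := (h.tendsto_gain hG hδ0 hδ1 i s i c).comp hφ.tendsto_atTop
    have h2 : Tendsto (fun n => G.aux δ i s (u (φ n) i)
        (Function.update (atState (x (φ n)) s) i (Pi.single c 1))) atTop
        (𝓝 (G.aux δ i s (Φ i) (Function.update (atState y s) i (Pi.single c 1)))) :=
      G.tendsto_aux δ i s (hu i) ((hx s).update i tendsto_const_nhds)
    rw [← hval i s, ← sub_nonpos]
    refine le_of_tendsto_of_tendsto' (h2.sub (hlim i s)) h1 fun n => ?_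
    simp only [Function.comp, gain, stagePayoff, aux_eq_mixedExt]
    exact le_max_left _ _
  refine ⟨hconv.mono fun y hy => hy.1, Φ, ?_, ?_, hconv⟩
  · exact tendsto_pi_nhds.2 fun i => tendsto_pi_nhds.2 fun s => hΦ i s
  · obtain ⟨N, hN⟩ := hconv 1 one_pos
    obtain ⟨y, hy, -⟩ := hN N le_rfl
    exact ⟨y, hy⟩

end IsWeightedFP

end Weighted

end StochGame

/-! ### Recurrence of plays of ergodic games -/

namespace StochGame

section Recurrence

variable {ι S : Type*} {A : ι → Type*}

theorem sum_real_inter_fiber {Ω Y : Type*} [MeasurableSpace Ω] (μ : Measure Ω) [IsFiniteMeasure μ]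
    [Fintype Y] {f : Ω → Y} (hf : ∀ y, MeasurableSet {ω | f ω = y}) (E : Set Ω) :
    ∑ y, μ.real (E ∩ {ω | f ω = y}) = μ.real E := by
  have h := sum_measureReal_preimage_singleton (μ := μ.restrict E) Finset.univ
    (f := f) fun y _ => hf y
  rw [Finset.coe_univ, Set.preimage_univ, measureReal_restrict_apply_univ] at h
  rw [← h]
  refine Finset.sum_congr rfl fun y _ => ?_
  rw [Set.inter_comm]
  exact (measureReal_restrict_apply (hf y)).symm

/-- The event that the play agrees with the states `p` and the action profiles `q` up to stage
`n`. -/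
def historyEvent {Ω : Type*} (s : ℕ → Ω → S) (a : ℕ → Ω → (∀ i, A i)) (n : ℕ) (p : ℕ → S)
    (q : ℕ → (∀ i, A i)) : Set Ω :=
  {ω | ∀ k ≤ n, s k ω = p k ∧ a k ω = q k}

theorem historyEvent_succ {Ω : Type*} (s : ℕ → Ω → S) (a : ℕ → Ω → (∀ i, A i)) (n : ℕ)
    (p : ℕ → S) (q : ℕ → (∀ i, A i)) (m : S) (b : ∀ i, A i) :
    historyEvent s a (n + 1) (Function.update p (n + 1) m) (Function.update q (n + 1) b) =
      historyEvent s a n p q ∩ {ω | s (n + 1) ω = m} ∩ {ω | a (n + 1) ω = b} := by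
  ext ω
  simp only [historyEvent, Set.mem_ofPred_eq, Set.mem_inter_iff, Nat.le_succ_iff]
  constructor
  · intro h
    have h1 := h (n + 1) (Or.inr rfl)
    simp only [Function.update_self] at h1
    refine ⟨⟨fun k hk => ?_, h1.1⟩, h1.2⟩
    have h2 := h k (Or.inl hk)
    rwa [Function.update_of_ne (by omega), Function.update_of_ne (by omega)] at h2
  · rintro ⟨⟨h1, h2⟩, h3⟩ k (hk | rfl)
    · rw [Function.update_of_ne (by omega), Function.update_of_ne (by omega)]
      exact h1 k hk
    · simpa using ⟨h2, h3⟩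

variable [Fintype S]

theorem IsPlay.real_transition {G : StochGame ι S A} {Ω : Type*} [MeasurableSpace Ω] {μ : Measure Ω}
    {s : ℕ → Ω → S} {a : ℕ → Ω → (∀ i, A i)} (h : G.IsPlay μ s a)
    (n : ℕ) (p : ℕ → S) (q : ℕ → (∀ i, A i)) (t : S) :
    μ.real (historyEvent s a n p q ∩ {ω | s (n + 1) ω = t}) =
      μ.real (historyEvent s a n p q) * (G.P (p n) (q n) : S → ℝ) t := by
  have := congrArg ENNReal.toReal (h.transition n p q t)
  rwa [ENNReal.toReal_mul, ENNReal.toReal_ofReal ((coe_mem_stdSimplex (G.P (p n) (q n))).1 t)]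
    at this

variable [DecidableEq S]

/-- The smallest probability, over all ways to choose actions, to be in state `t` after `k` steps
from `s`. -/
noncomputable def minReach (G : StochGame ι S A) (t : S) : ℕ → S → ℝ
  | 0, s => if s = t then 1 else 0
  | k + 1, s => ⨅ a : (∀ i, A i), ∑ m, (G.P s a : S → ℝ) m * minReach G t k m

/-- The minimum is attained by a Markov policy, so it is one of the probabilities that ergodicity
asserts to be positive. -/
theorem exists_stepProb_eq_minReach [Finite (∀ i, A i)] [Nonempty (∀ i, A i)]
    (G : StochGame ι S A) (t : S) (T : ℕ) :
    ∃ c : ℕ → S → (∀ i, A i), ∀ s, G.stepProb c T s t = G.minReach t T s := by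
  have hopt : ∀ k s, ∃ a : (∀ i, A i),
      ∑ m, (G.P s a : S → ℝ) m * G.minReach t k m = G.minReach t (k + 1) s := fun k s =>
    exists_eq_ciInf_of_finite
  choose o ho using hopt
  -- backward induction: at stage `j` there remain `T - 1 - j` steps after the current one
  refine ⟨fun j => o (T - 1 - j), fun s => ?_⟩
  have key : ∀ j ≤ T, ∑ m, G.stepProb (fun j => o (T - 1 - j)) j s m * G.minReach t (T - j) m =
      G.minReach t T s := by
    intro j
    induction j with
    | zero => simp [stepProb]
    | succ j ih =>
      intro hj
      rw [← ih (Nat.le_of_succ_le hj)]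
      simp only [stepProb, Finset.sum_mul]
      rw [Finset.sum_comm]
      refine Finset.sum_congr rfl fun m _ => ?_
      rw [show T - j = T - 1 - j + 1 by omega, ← ho, Finset.mul_sum,
        show T - (j + 1) = T - 1 - j by omega]
      exact Finset.sum_congr rfl fun m' _ => mul_assoc _ _ _
  rw [← key T le_rfl]
  simp [minReach]

theorem minReach_succ_le [Finite (∀ i, A i)] (G : StochGame ι S A) (t : S) (k : ℕ) (m : S)
    (b : ∀ i, A i) :
    G.minReach t (k + 1) m ≤ ∑ m', (G.P m b : S → ℝ) m' * G.minReach t k m' :=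
  ciInf_le (Set.finite_range _).bddBelow b

namespace IsPlay

variable {G : StochGame ι S A} {Ω : Type*} [MeasurableSpace Ω] {μ : Measure Ω}
  {s : ℕ → Ω → S} {a : ℕ → Ω → (∀ i, A i)}

variable [Fintype (∀ i, A i)]

/-- Given the past, state `t` is met `k + 1` stages later with at least the minimal probability. -/
theorem minReach_mul_le [IsFiniteMeasure μ] (h : G.IsPlay μ s a) (t : S) (k n : ℕ) (p : ℕ → S)
    (q : ℕ → (∀ i, A i)) :
    (∑ m, (G.P (p n) (q n) : S → ℝ) m * G.minReach t k m) * μ.real (historyEvent s a n p q) ≤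
      μ.real (historyEvent s a n p q ∩ {ω | s (n + k + 1) ω = t}) := by
  induction k generalizing n p q with
  | zero =>
    simp only [minReach, add_zero, mul_ite, mul_one, mul_zero, Finset.sum_ite_eq',
      Finset.mem_univ, if_true]
    rw [h.real_transition, mul_comm]
  | succ k ih =>
    set H := historyEvent s a n p q
    set E := {ω | s (n + (k + 1) + 1) ω = t}
    calc (∑ m, (G.P (p n) (q n) : S → ℝ) m * G.minReach t (k + 1) m) * μ.real H
        = ∑ m, G.minReach t (k + 1) m * μ.real (H ∩ {ω | s (n + 1) ω = m}) := by
          rw [Finset.sum_mul]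
          refine Finset.sum_congr rfl fun m _ => ?_
          rw [h.real_transition]
          ring
      _ = ∑ m, ∑ b, G.minReach t (k + 1) m *
            μ.real (H ∩ {ω | s (n + 1) ω = m} ∩ {ω | a (n + 1) ω = b}) := by
          refine Finset.sum_congr rfl fun m _ => ?_
          rw [← Finset.mul_sum, sum_real_inter_fiber μ (h.measurable_action (n + 1))]
      _ ≤ ∑ m, ∑ b, μ.real (H ∩ E ∩ {ω | s (n + 1) ω = m} ∩ {ω | a (n + 1) ω = b}) := by
          refine Finset.sum_le_sum fun m _ => Finset.sum_le_sum fun b _ => ?_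
          have h1 := ih (n + 1) (Function.update p (n + 1) m) (Function.update q (n + 1) b)
          rw [historyEvent_succ, Function.update_self, Function.update_self] at h1
          refine (mul_le_mul_of_nonneg_right (minReach_succ_le G t k m b)
            measureReal_nonneg).trans (h1.trans_eq (congrArg μ.real ?_))
          rw [show n + 1 + k + 1 = n + (k + 1) + 1 by omega]
          ext ω
          simp only [Set.mem_inter_iff]
          tauto
      _ = μ.real (H ∩ E) := by
          simp only [sum_real_inter_fiber μ (h.measurable_action (n + 1)),
            sum_real_inter_fiber μ (h.measurable_state (n + 1))]

/-- The bound of `minReach_mul_le` for an event `F` that is determined by the play up to stage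
`n`. -/
theorem mul_real_le_of_determined [IsFiniteMeasure μ] (h : G.IsPlay μ s a) {t : S} {k : ℕ} {η : ℝ}
    (hη : ∀ m, η ≤ G.minReach t (k + 1) m) (n : ℕ) {F : Set Ω}
    (hF : ∀ ω ω', (∀ j ≤ n, s j ω' = s j ω ∧ a j ω' = a j ω) → ω ∈ F → ω' ∈ F) :
    η * μ.real F ≤ μ.real (F ∩ {ω | s (n + k + 1) ω = t}) := by
  let hist : Ω → (Fin (n + 1) → S × (∀ i, A i)) := fun ω j => (s j ω, a j ω)
  have hmeas : ∀ y, MeasurableSet {ω | hist ω = y} := fun y => by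
    have : {ω | hist ω = y} = ⋂ j : Fin (n + 1), ({ω | s j ω = (y j).1} ∩ {ω | a j ω = (y j).2}) := by
      ext ω
      simp [hist, funext_iff, Prod.ext_iff]
    rw [this]
    exact MeasurableSet.iInter fun j =>
      (h.measurable_state j _).inter (h.measurable_action j _)
  rw [← sum_real_inter_fiber μ hmeas F, ← sum_real_inter_fiber μ hmeas (F ∩ _), Finset.mul_sum]
  refine Finset.sum_le_sum fun y _ => ?_
  -- each set of the partition by histories is either disjoint from `F` or contained in it
  rcases (F ∩ {ω | hist ω = y}).eq_empty_or_nonempty with hE | ⟨ω₀, h₀F, h₀y⟩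
  · rw [hE]
    simp
  have hfib : ∀ ω, hist ω = y ↔ ∀ j ≤ n, s j ω = s j ω₀ ∧ a j ω = a j ω₀ := fun ω => by
    rw [← (h₀y : hist ω₀ = y), funext_iff]
    exact ⟨fun hy j hj => Prod.ext_iff.1 (hy ⟨j, Nat.lt_succ_of_le hj⟩),
      fun hy j => Prod.ext_iff.2 (hy j (Nat.le_of_lt_succ j.2))⟩
  have h1 : F ∩ {ω | hist ω = y} = historyEvent s a n (fun j => s j ω₀) (fun j => a j ω₀) := by
    ext ω
    exact ⟨fun hω => (hfib ω).1 hω.2, fun hω => ⟨hF ω₀ ω hω h₀F, (hfib ω).2 hω⟩⟩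
  rw [Set.inter_right_comm, h1]
  exact (mul_le_mul_of_nonneg_right ((hη _).trans (minReach_succ_le G t k _ _))
    measureReal_nonneg).trans (h.minReach_mul_le t k n _ _)

/-- In an ergodic game, almost surely every state is visited infinitely often. -/
theorem ae_frequently_visited [IsProbabilityMeasure μ] (h : G.IsPlay μ s a) (hG : G.Ergodic) :
    ∀ᵐ ω ∂μ, ∀ t, ∃ᶠ n in atTop, s n ω = t := by
  obtain ⟨T, hT⟩ := hG
  rcases isEmpty_or_nonempty (∀ i, A i) with hA | hA
  · exact Eventually.of_forall fun ω => isEmptyElim (a 0 ω)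
  -- zero steps reach every state only if there is at most one state
  rcases T with _ | k
  · have hsub : ∀ s t : S, s = t := fun s t => by
      have := hT (fun _ _ => Classical.arbitrary _) s t
      by_contra hst
      simp [stepProb, hst] at this
    exact Eventually.of_forall fun ω t => Frequently.of_forall fun n => hsub _ _
  rw [ae_all_iff]
  intro t
  obtain ⟨η, hη0, hη1, hη⟩ : ∃ η : ℝ, 0 < η ∧ η ≤ 1 ∧ ∀ m, η ≤ G.minReach t (k + 1) m := by
    obtain ⟨c, hc⟩ := G.exists_stepProb_eq_minReach t (k + 1)
    rcases isEmpty_or_nonempty S with hS | hS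
    · exact ⟨1, one_pos, le_rfl, fun m => isEmptyElim m⟩
    obtain ⟨m₀, hm₀⟩ := Finite.exists_min (G.minReach t (k + 1))
    refine ⟨min (G.minReach t (k + 1) m₀) 1, lt_min ?_ one_pos, min_le_right _ _, fun m =>
      (min_le_left _ _).trans (hm₀ m)⟩
    rw [← hc]
    exact hT c m₀ t
  have hnull : ∀ N, μ {ω | ∀ n ≥ N, s n ω ≠ t} = 0 := fun N => by
    -- `t` is avoided at each of `j` test times with spacing `k + 1`
    let F : ℕ → Set Ω := fun j => {ω | ∀ i < j, s (N + i * (k + 1) + k + 1) ω ≠ t}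
    have hle : ∀ j, μ.real (F j) ≤ (1 - η) ^ j := fun j => by
      induction j with
      | zero => simp
      | succ j ih =>
        have h1 := h.mul_real_le_of_determined hη (N + j * (k + 1)) (F := F j)
          fun ω ω' hω hωF i hi => by
            have hij : (i + 1) * (k + 1) ≤ j * (k + 1) := Nat.mul_le_mul_right _ hi
            rw [(hω _ (by linarith)).1]
            exact hωF i hi
        have h2 := measureReal_inter_add_sdiff (μ := μ) (s := F j)
          (h.measurable_state (N + j * (k + 1) + k + 1) t)
        have h3 : F (j + 1) = F j \ {ω | s (N + j * (k + 1) + k + 1) ω = t} := by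
          ext ω
          simp only [F, Set.mem_ofPred_eq, Set.mem_sdiff, Nat.lt_succ_iff_lt_or_eq]
          exact ⟨fun hω => ⟨fun i hi => hω i (Or.inl hi), hω j (Or.inr rfl)⟩,
            fun hω i hi => hi.elim (hω.1 i) fun hij => hij ▸ hω.2⟩
        rw [h3, pow_succ]
        nlinarith
    have hlim := tendsto_pow_atTop_nhds_zero_of_lt_one (sub_nonneg.2 hη1) (sub_lt_self 1 hη0)
    have hreal : μ.real {ω | ∀ n ≥ N, s n ω ≠ t} ≤ 0 := by
      refine ge_of_tendsto' hlim fun j => le_trans (measureReal_mono ?_) (hle j)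
      exact fun ω hω i _ => hω _ (by rw [add_assoc, add_assoc]; exact Nat.le_add_right _ _)
    exact (measureReal_eq_zero_iff).1 (le_antisymm hreal measureReal_nonneg)
  have hae : ∀ᵐ ω ∂μ, ∀ N, ∃ n ≥ N, s n ω = t := by
    rw [ae_all_iff]
    intro N
    rw [ae_iff]
    simpa only [not_exists, not_and] using hnull N
  filter_upwards [hae] with ω hω
  exact frequently_atTop.2 hω

end IsPlay

end Recurrence

end StochGame

/-! ### The two procedures as weighted fictitious play -/

namespace StochGame

theorem StepSizes.stepSum_pos {α : ℕ → ℝ} (h : StepSizes α) (n : ℕ) : 0 < stepSum α n :=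
  Finset.sum_pos (fun k _ => h.pos k) ⟨0, by simp⟩

theorem StepSizes.ratio_nonneg {α : ℕ → ℝ} (h : StepSizes α) (n : ℕ) :
    0 ≤ α n / stepSum α n :=
  (div_pos (h.pos n) (h.stepSum_pos n)).le

theorem StepSizes.ratio_le_one {α : ℕ → ℝ} (h : StepSizes α) (n : ℕ) :
    α n / stepSum α n ≤ 1 := by
  rw [div_le_one (h.stepSum_pos n)]
  exact Finset.single_le_sum (fun k _ => (h.pos k).le) (Finset.self_mem_range_succ n)

theorem StepSizes.not_summable {α : ℕ → ℝ} (h : StepSizes α) :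
    ¬ Summable fun n => α n / stepSum α n :=
  (not_summable_iff_tendsto_nat_atTop_of_nonneg h.ratio_nonneg).2 h.diverge

theorem summable_one_div_succ_sq : Summable fun n : ℕ => (1 / ((n : ℝ) + 1)) ^ 2 := by
  have := (summable_nat_add_iff 1).2 (Real.summable_one_div_nat_pow.2 one_lt_two)
  simpa [one_div] using this

theorem not_summable_one_div_succ : ¬ Summable fun n : ℕ => 1 / ((n : ℝ) + 1) := by
  have := mt (summable_nat_add_iff 1).1 Real.not_summable_one_div_natCast
  simpa using this

theorem one_div_succ_le_one (n : ℕ) : 1 / ((n : ℝ) + 1) ≤ 1 := by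
  rw [div_le_one (by positivity)]
  linarith [(Nat.cast_nonneg n : (0 : ℝ) ≤ n)]

section Visits

variable {S : Type*} [DecidableEq S]

theorem visits_eq_count (s : ℕ → S) (t : S) (n : ℕ) :
    visits s t n = Nat.count (fun k => s k = t) (n + 1) := by
  rw [visits, Nat.count_eq_card_filter_range]

/-- Only the stages that visit `t` contribute to the weights of `t`, and they contribute `1`, `1/2`,
`1/3`, ... -/
theorem sum_visit_weight_pow (s : ℕ → S) (t : S) {e : ℕ} (he : e ≠ 0) (N : ℕ) :
    ∑ n ∈ Finset.range N, ((if s n = t then (1 : ℝ) else 0) / visits s t n) ^ e =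
      ∑ k ∈ Finset.range (Nat.count (fun k => s k = t) N), (1 / ((k : ℝ) + 1)) ^ e := by
  induction N with
  | zero => simp
  | succ N ih =>
    rw [Finset.sum_range_succ, ih, visits_eq_count, Nat.count_succ]
    by_cases hN : s N = t
    · simp [hN, Finset.sum_range_succ]
    · simp [hN, he]

theorem visit_weight_nonneg (s : ℕ → S) (t : S) (n : ℕ) :
    0 ≤ (if s n = t then (1 : ℝ) else 0) / visits s t n := by
  split_ifs <;> positivity

theorem visit_weight_le_one (s : ℕ → S) (t : S) (n : ℕ) :
    (if s n = t then (1 : ℝ) else 0) / visits s t n ≤ 1 := by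
  split_ifs with h
  · rw [visits_eq_count, Nat.count_succ, if_pos h]
    push_cast
    exact one_div_succ_le_one _
  · simp

theorem summable_visit_weight_sq (s : ℕ → S) (t : S) :
    Summable fun n => ((if s n = t then (1 : ℝ) else 0) / visits s t n) ^ 2 := by
  refine summable_of_sum_range_le (c := ∑' k : ℕ, (1 / ((k : ℝ) + 1)) ^ 2)
    (fun n => sq_nonneg _) fun N => ?_
  rw [sum_visit_weight_pow s t two_ne_zero]
  exact sum_le_tsum_range summable_one_div_succ_sq (fun k => sq_nonneg _) _

theorem not_summable_visit_weight {s : ℕ → S} {t : S} (h : ∃ᶠ n in atTop, s n = t) :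
    ¬ Summable fun n => (if s n = t then (1 : ℝ) else 0) / visits s t n := by
  rw [not_summable_iff_tendsto_nat_atTop_of_nonneg (visit_weight_nonneg s t)]
  have hcount : Tendsto (Nat.count fun k => s k = t) atTop atTop :=
    tendsto_atTop_atTop_of_monotone (Nat.count_monotone _) fun n =>
      ⟨Nat.nth _ n, (Nat.count_nth_of_infinite (Nat.frequently_atTop_iff_infinite.1 h) n).ge⟩
  have hharm := (not_summable_iff_tendsto_nat_atTop_of_nonneg
    (fun n : ℕ => (by positivity : (0 : ℝ) ≤ 1 / ((n : ℝ) + 1)))).1 not_summable_one_div_succ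
  refine (hharm.comp hcount).congr fun N => ?_
  simpa using (sum_visit_weight_pow s t one_ne_zero N).symm

end Visits

section Procedures

variable {ι S : Type*} {A : ι → Type*} [Fintype ι] [DecidableEq ι] [Fintype S]
  [∀ i, Fintype (A i)] [∀ i, DecidableEq (A i)] {G : StochGame ι S A} {δ : ℝ} {α : ℕ → ℝ}

theorem IsSFP.isWeightedFP {a : ℕ → S → (∀ i, A i)} {x : ℕ → StationaryProfile S A}
    {u : ℕ → ι → S → ℝ} (h : G.IsSFP δ α a x u) (hα : StepSizes α) :
    G.IsWeightedFP δ (fun n => α n / stepSum α n) (fun n _ => 1 / ((n : ℝ) + 1)) a x u where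
  γ_nonneg := hα.ratio_nonneg
  γ_le_one := hα.ratio_le_one
  γ_diverge := hα.not_summable
  w_nonneg n _ := by positivity
  w_le_one n _ := one_div_succ_le_one n
  w_diverge _ := not_summable_one_div_succ
  w_sq _ := summable_one_div_succ_sq
  init := h.payoff_update.1
  payoff_update := h.payoff_update.2
  action_update := h.action_update
  best_response n i s _ := h.best_response n i s

theorem IsAFP.isWeightedFP [DecidableEq S] {s : ℕ → S} {a : ℕ → (∀ i, A i)}
    {x : ℕ → StationaryProfile S A} {u : ℕ → ι → S → ℝ} (h : G.IsAFP δ α s a x u)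
    (hα : StepSizes α) (hs : ∀ t, ∃ᶠ n in atTop, s n = t) :
    G.IsWeightedFP δ (fun n => α n / stepSum α n)
      (fun n t => (if s n = t then (1 : ℝ) else 0) / visits s t n) (fun n _ => a n) x u where
  γ_nonneg := hα.ratio_nonneg
  γ_le_one := hα.ratio_le_one
  γ_diverge := hα.not_summable
  w_nonneg n t := visit_weight_nonneg s t n
  w_le_one n t := visit_weight_le_one s t n
  w_diverge t := not_summable_visit_weight (hs t)
  w_sq t := summable_visit_weight_sq s t
  init := h.payoff_update.1
  payoff_update := h.payoff_update.2
  action_update := h.action_update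
  best_response n i t hw := by
    have hst : s n = t := by
      by_contra hst
      simp [hst] at hw
    exact hst ▸ h.best_response n i

end Procedures

end StochGame

theorem mainTheorem1 {ι S : Type*} {A : ι → Type*} [Fintype ι] [DecidableEq ι]
    [Fintype S] [DecidableEq S] [∀ i, Fintype (A i)] [∀ i, DecidableEq (A i)]
    (G : StochGame ι S A) (hG : G.IdenticalInterest)
    (δ : ℝ) (hδ0 : 0 < δ) (hδ1 : δ < 1)
    (α : ℕ → ℝ) (hα : StochGame.StepSizes α) :
    (∀ (a : ℕ → S → (∀ i, A i)) (x : ℕ → StationaryProfile S A) (u : ℕ → ι → S → ℝ),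
      G.IsSFP δ α a x u → G.ConvergesToEquilibria δ x u) ∧
    (G.Ergodic →
      ∀ {Ω : Type*} [MeasurableSpace Ω] (μ : Measure Ω) [IsProbabilityMeasure μ]
        (s : ℕ → Ω → S) (a : ℕ → Ω → (∀ i, A i))
        (x : ℕ → Ω → StationaryProfile S A) (u : ℕ → Ω → ι → S → ℝ),
        G.IsPlay μ s a →
        (∀ᵐ ω ∂μ, G.IsAFP δ α (fun n => s n ω) (fun n => a n ω)
          (fun n => x n ω) (fun n => u n ω)) →
        ∀ᵐ ω ∂μ, G.ConvergesToEquilibria δ (fun n => x n ω) (fun n => u n ω)) := by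
  refine ⟨fun a x u h => (h.isWeightedFP hα).convergesToEquilibria hG hδ0 hδ1, ?_⟩
  intro hE Ω _ μ _ s a x u hplay hAFP
  filter_upwards [hAFP, hplay.ae_frequently_visited hE] with ω h hs
  exact (h.isWeightedFP hα hs).convergesToEquilibria hG hδ0 hδ1
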